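/- Let ${\mathfrak D}$ be a unital $C^*$-algebra, ${\mathfrak B}\subseteq{\mathfrak D}$ a $C^*$-subalgebra with the same unit, and $E^{\mathfrak D}_{\mathfrak B}:{\mathfrak D}\to{\mathfrak B}$ a conditional expectation, i.e. a linear projection of ${\mathfrak D}$ onto ${\mathfrak B}$ with $\|E^{\mathfrak D}_{\mathfrak B}(x)\|\le\|x\|$ for all $x$. Put ${\mathfrak D}^\circ=\ker E^{\mathfrak D}_{\mathfrak B}$. Let $({\mathfrak A},E)=(*_{\mathfrak B})_{i\in\mathbb Z}({\mathfrak A}_i,E_i)$ be the reduced amalgamated free product of copies $({\mathfrak A}_i,E_i)$ of $({\mathfrak D},E^{\mathfrak D}_{\mathfrak B})$. Explicitly, let ${\mathcal E}$ be the Hilbert right ${\mathfrak B}$-module which is the orthogonal direct sum of ${\mathfrak B}$ and of the modules ${\mathfrak D}^\circ_{i_1}\otimes_{\mathfrak B}\cdots\otimes_{\mathfrak B}{\mathfrak D}^\circ_{i_n}$ with $n\ge1$, $i_1\ne i_2\ne\cdots\ne i_n$ in $\mathbb Z$, that is, the separated completion of the right ${\mathfrak B}$-module spanned by the words $a_1\otimes\cdots\otimes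 a_n b$ for the ${\mathfrak B}$-valued inner product (conjugate linear in the first variable) under which words with different index sequences are orthogonal and $$\langle a_1\otimes\cdots\otimes a_n b,\;c_1\otimes\cdots\otimes c_n d\rangle=b^*E^{\mathfrak D}_{\mathfrak B}\big(a_n^*\cdots E^{\mathfrak D}_{\mathfrak B}(a_2^*E^{\mathfrak D}_{\mathfrak B}(a_1^*c_1)c_2)\cdots c_n\big)d$$ for words with the same index sequence $(i_1,\dots,i_n)$. For $i\in\mathbb Z$ and $a\in{\mathfrak D}$ let $\lambda^i_a$ be the adjointable operator on ${\mathcal E}$ with $$\lambda^i_a(d\otimes w)=\big(ad-E^{\mathfrak D}_{\mathfrak B}(ad)\big)\otimes w+E^{\mathfrak D}_{\mathfrak B}(ad)\,w$$ whenever $w$ is a word (with coefficient in ${\mathfrak B}$) whose first index is not $i$ and either $d\in{\mathfrak D}^\circ_i$, or $d={\bf 1}$ (in which case $d\otimes w$ means $w$). Then ${\mathfrak A}$ is the $C^*$-algebra generated by $\{\lambda^i_a : i\in\mathbb Z,\ a\in{\mathfrak D}\}$. For $b\in{\mathfrak B}$ the operator $\lambda^i_b$ does not depend on $i$, and $b\in{\mathfrak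 B}$ is identified with it. Finally $E(x)=\langle{\bf 1},x{\bf 1}\rangle\in{\mathfrak B}$ for $x\in{\mathfrak A}$, where ${\bf 1}\in{\mathfrak B}\subseteq{\mathcal E}$. **Theorem 3.1.** There is exactly one automorphism $\alpha$ of the $C^*$-algebra ${\mathfrak A}$, the free shift, with $\alpha(\lambda^i_a)=\lambda^{i+1}_a$ for all $i\in\mathbb Z$ and $a\in{\mathfrak D}$. The map $E$ is a conditional expectation of ${\mathfrak A}$ onto the fixed-point subalgebra ${\mathfrak A}^\alpha=\{x\in{\mathfrak A}:\alpha(x)=x\}$, and $\alpha$ is $E$-mixing: for every state $\varphi$ of ${\mathfrak A}$ and every $x\in{\mathfrak A}$, $$\lim_{n\to\infty}\varphi(\alpha^n(x))=\varphi(E(x)).$$ -/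

import Mathlib

/-!
Reduced amalgamated free products of copies of one C*-algebra.

Given unital C*-algebras `B ⊆ D` and a conditional expectation `exp : D → B`, write `D°` for the
kernel of `exp`.  The Hilbert right `B`-module of the reduced amalgamated free product over an
index set `ι` is the orthogonal sum of `B` and of the modules `D°_{i₁} ⊗_B ⋯ ⊗_B D°_{iₙ}`, where
`i₁ ≠ i₂ ≠ ⋯ ≠ iₙ`.  It is realised here as the separated completion of the free right `B`-module
on the words `(i₁, a₁) ⋯ (iₙ, aₙ)` for the `B`-valued semi-inner product
`⟨a₁ ⊗ ⋯ ⊗ aₙ b, c₁ ⊗ ⋯ ⊗ cₙ d⟩ = b* exp (aₙ* ⋯ exp (a₂* exp (a₁* c₁) c₂) ⋯ cₙ) d`.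
All inner products are conjugate linear in the first variable.
-/

set_option linter.unusedSectionVars false
noncomputable section
section Tomiyama
open scoped ComplexStarModule

attribute [local instance] CStarAlgebra.spectralOrder CStarAlgebra.spectralOrderedRing

/-- A conditional expectation `exp` of `D` onto the unital C*-subalgebra `B` (with inclusion `incl`):
a projection that is contractive. The bimodule property, positivity, and so on are proved below. -/
structure CondExp (D B : Type*) [CStarAlgebra D] [CStarAlgebra B] where
  incl : B →⋆ₐ[ℂ] D
  exp : D →ₗ[ℂ] B
  exp_incl : ∀ b, exp (incl b) = b
  norm_exp_le : ∀ x, ‖exp x‖ ≤ ‖x‖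

namespace CondExp
variable {D B : Type*} [CStarAlgebra D] [CStarAlgebra B] (P : CondExp D B)

lemma exp_one : P.exp 1 = 1 := by
  simpa using P.exp_incl 1

lemma norm_one_le' (D : Type*) [CStarAlgebra D] : ‖(1 : D)‖ ≤ 1 := by
  rcases subsingleton_or_nontrivial D with h | h
  · rw [Subsingleton.elim (1 : D) 0]; simp
  · exact CStarRing.norm_one.le

lemma norm_incl_le (b : B) : ‖P.incl b‖ ≤ ‖b‖ := NonUnitalStarAlgHom.norm_apply_le P.incl b

lemma le_zero_of_forall_smul_le {v : B} {C : ℝ} (h : ∀ t : ℝ, 0 < t → t • v ≤ algebraMap ℝ B C) :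
    v ≤ 0 := by
  have h1 : ∀ t : ℝ, 0 < t → v ≤ algebraMap ℝ B (C * t) := by
    intro t ht
    have := smul_le_smul_of_nonneg_left (h t⁻¹ (inv_pos.2 ht)) ht.le
    rw [smul_smul, mul_inv_cancel₀ ht.ne', one_smul] at this
    refine this.trans_eq ?_
    rw [Algebra.algebraMap_eq_smul_one, Algebra.algebraMap_eq_smul_one, smul_smul, mul_comm]
  have h2 : Filter.Tendsto (fun t : ℝ => algebraMap ℝ B (C * t)) (nhdsWithin 0 (Set.Ioi 0))
      (nhds 0) := by
    have : Continuous (fun t : ℝ => algebraMap ℝ B (C * t)) := by fun_prop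
    have h3 := (this.tendsto 0).mono_left (nhdsWithin_le_nhds (s := Set.Ioi 0))
    simpa using h3
  exact ge_of_tendsto h2 (by filter_upwards [self_mem_nhdsWithin] with t ht using h1 t ht)

lemma isSelfAdjoint_exp {h : D} (hh : IsSelfAdjoint h) : IsSelfAdjoint (P.exp h) := by
  set u : B := (ℜ (P.exp h) : B) with hu
  set v : B := (ℑ (P.exp h) : B) with hv
  have huv : P.exp h = u + Complex.I • v := (realPart_add_I_smul_imaginaryPart _).symm
  have hvs : IsSelfAdjoint v := (ℑ (P.exp h)).2
  have hus : IsSelfAdjoint u := (ℜ (P.exp h)).2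
  have key : ∀ t : ℝ, (v + algebraMap ℝ B t) * (v + algebraMap ℝ B t)
      ≤ algebraMap ℝ B (‖h‖ ^ 2 + t ^ 2) := by
    intro t
    have e1 : ‖P.exp (h + (Complex.I * t) • 1)‖ ^ 2 ≤ ‖h‖ ^ 2 + t ^ 2 := by
      have a1 := P.norm_exp_le (h + (Complex.I * t) • 1)
      have a2 : ‖h + (Complex.I * t) • (1 : D)‖ ^ 2 ≤ ‖h‖ ^ 2 + t ^ 2 := by
        rw [sq, ← CStarRing.norm_star_mul_self]
        have : star (h + (Complex.I * t) • (1 : D)) * (h + (Complex.I * t) • (1 : D))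
            = h * h + ((t ^ 2 : ℝ) : ℂ) • (1 : D) := by
          simp only [star_add, star_smul, hh.star_eq, star_one, add_mul, mul_add, smul_mul_assoc,
            mul_smul_comm, one_mul, mul_one]
          simp only [star_mul', RCLike.star_def, Complex.conj_I, Complex.conj_ofReal]
          have : (-Complex.I * (t : ℂ)) * (Complex.I * t) = ((t ^ 2 : ℝ) : ℂ) := by
            push_cast
            linear_combination (-(t : ℂ) ^ 2) * Complex.I_sq
          rw [← this]
          module
        rw [this]
        refine (norm_add_le _ _).trans ?_
        gcongr
        · exact (norm_mul_le _ _).trans_eq (sq _).symm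
        · rw [norm_smul]
          calc _ ≤ ‖((t ^ 2 : ℝ) : ℂ)‖ * 1 := by gcongr; exact norm_one_le' D
            _ = t ^ 2 := by simp
      calc _ ≤ ‖h + (Complex.I * t) • (1 : D)‖ ^ 2 := by gcongr
        _ ≤ _ := a2
    have e2 : P.exp (h + (Complex.I * t) • 1) = u + Complex.I • (v + algebraMap ℝ B t) := by
      rw [map_add, map_smul, P.exp_one, huv, Algebra.algebraMap_eq_smul_one, smul_add, mul_smul,
        Complex.coe_smul, add_assoc]
    have hws : IsSelfAdjoint (v + algebraMap ℝ B t) :=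
      hvs.add (IsSelfAdjoint.algebraMap _ (IsSelfAdjoint.all t))
    set w := v + algebraMap ℝ B t with hw
    have e3 : ‖w‖ ≤ ‖u + Complex.I • w‖ := by
      have : w = ((ℑ (u + Complex.I • w) : selfAdjoint B) : B) := by
        have h1 : ℑ u = 0 := hus.imaginaryPart
        have h2 : ((ℜ w : selfAdjoint B) : B) = w := hws.coe_realPart
        rw [map_add, h1, zero_add, imaginaryPart_I_smul, h2]
      conv_lhs => rw [this]
      have := imaginaryPart.norm_le (u + Complex.I • w)
      exact this
    have e4 : ‖w * w‖ ≤ ‖h‖ ^ 2 + t ^ 2 := by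
      refine (norm_mul_le _ _).trans ?_
      rw [← sq]
      rw [e2] at e1
      exact le_trans (by gcongr) e1
    have e5 : IsSelfAdjoint (w * w) := by
      rw [← sq]; exact hws.pow 2
    exact e5.le_algebraMap_norm_self.trans (by
      rw [Algebra.algebraMap_eq_smul_one, Algebra.algebraMap_eq_smul_one]
      exact smul_le_smul_of_nonneg_right e4 zero_le_one)
  have hvv : 0 ≤ v * v := by
    have := star_mul_self_nonneg v
    rwa [hvs.star_eq] at this
  have key2 : ∀ t : ℝ, (2 * t) • v ≤ algebraMap ℝ B (‖h‖ ^ 2) := by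
    intro t
    have h1 := key t
    have h2 : (v + algebraMap ℝ B t) * (v + algebraMap ℝ B t)
        = v * v + (2 * t) • v + algebraMap ℝ B (t ^ 2) := by
      simp only [Algebra.algebraMap_eq_smul_one, add_mul, mul_add, smul_mul_assoc, mul_smul_comm,
        one_mul, mul_one]
      module
    rw [h2, map_add] at h1
    have h3 : v * v + (2 * t) • v ≤ algebraMap ℝ B (‖h‖ ^ 2) := le_of_add_le_add_right h1
    exact le_trans (le_add_of_nonneg_left hvv) h3
  have hv0 : v ≤ 0 := le_zero_of_forall_smul_le (C := ‖h‖ ^ 2) (fun t _ => by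
    have := key2 (t / 2); rwa [mul_div_cancel₀ _ two_ne_zero] at this)
  have hv1 : -v ≤ 0 := le_zero_of_forall_smul_le (C := ‖h‖ ^ 2) (fun t _ => by
    have := key2 (-(t / 2))
    have e : (2 * -(t / 2)) • v = t • (-v) := by module
    rwa [e] at this)
  have : v = 0 := le_antisymm hv0 (by simpa using hv1)
  rw [huv, this, smul_zero, add_zero]
  exact hus

lemma exp_star (x : D) : P.exp (star x) = star (P.exp x) := by
  have h := realPart_add_I_smul_imaginaryPart x
  have h1 : star (P.exp (ℜ x : D)) = P.exp (ℜ x : D) := (P.isSelfAdjoint_exp (ℜ x).2).star_eq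
  have h2 : star (P.exp (ℑ x : D)) = P.exp (ℑ x : D) := (P.isSelfAdjoint_exp (ℑ x).2).star_eq
  have h3 : star (ℜ x : D) = ℜ x := (ℜ x).2
  have h4 : star (ℑ x : D) = ℑ x := (ℑ x).2
  conv_lhs => rw [← h]
  conv_rhs => rw [← h]
  simp only [star_add, star_smul, map_add, map_smul, h1, h2, h3, h4]

lemma exp_nonneg {x : D} (hx : 0 ≤ x) : 0 ≤ P.exp x := by
  have h1 : ‖P.exp (algebraMap ℝ D ‖x‖ - x)‖ ≤ ‖x‖ := by
    refine (P.norm_exp_le _).trans ?_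
    refine (CStarAlgebra.norm_le_iff_le_algebraMap _ (norm_nonneg x) ?_).2 ?_
    · exact sub_nonneg.2 (IsSelfAdjoint.of_nonneg hx).le_algebraMap_norm_self
    · exact sub_le_self _ hx
  have h2 : P.exp (algebraMap ℝ D ‖x‖ - x) = algebraMap ℝ B ‖x‖ - P.exp x := by
    rw [map_sub, Algebra.algebraMap_eq_smul_one, Algebra.algebraMap_eq_smul_one,
      ← Complex.coe_smul, map_smul, P.exp_one, Complex.coe_smul]
  rw [h2] at h1
  have h3 : IsSelfAdjoint (algebraMap ℝ B ‖x‖ - P.exp x) :=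
    (IsSelfAdjoint.algebraMap _ (IsSelfAdjoint.all _)).sub
      (P.isSelfAdjoint_exp (IsSelfAdjoint.of_nonneg hx))
  have h5 : algebraMap ℝ B ‖algebraMap ℝ B ‖x‖ - P.exp x‖ ≤ algebraMap ℝ B ‖x‖ := by
    simp only [Algebra.algebraMap_eq_smul_one] at h1 ⊢
    exact smul_le_smul_of_nonneg_right h1 zero_le_one
  have h4 := h3.le_algebraMap_norm_self.trans h5
  simpa using h4

lemma mul_exp_eq_zero {f g : B} (hfg : star f * g = 0) (hg : 0 ≤ g) (hg1 : ‖g‖ ≤ 1) (x : D) :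
    g * P.exp (P.incl f * x) = 0 := by
  set c := P.exp (P.incl f * x) with hc
  have hgs : star g = g := (IsSelfAdjoint.of_nonneg hg).star_eq
  have hgf : g * f = 0 := by
    have := congrArg star hfg
    simpa [hgs] using this
  set p := star c * (g * g) * c with hp
  have hp0 : 0 ≤ p := by
    have := star_mul_self_nonneg (g * c)
    rw [star_mul, hgs] at this
    simpa [hp, mul_assoc] using this
  set C := ‖star x * P.incl (star f * f) * x‖ with hC
  have hgg : g * g ≤ g := by
    have h1 : g ≤ 1 := (CStarAlgebra.norm_le_one_iff_of_nonneg g hg).1 hg1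
    have := CStarAlgebra.pow_antitone hg h1 (show 1 ≤ 2 by norm_num)
    simpa [sq] using this
  have key : ∀ t : ℝ, 0 < t → 2 * t * ‖p‖ ≤ C := by
    intro t ht
    have a1 : ‖c + (t : ℂ) • (g * c)‖ ≤ ‖P.incl f * x + (t : ℂ) • P.incl (g * c)‖ := by
      have := P.norm_exp_le (P.incl f * x + (t : ℂ) • P.incl (g * c))
      rwa [map_add, map_smul, P.exp_incl, ← hc] at this
    have a2 : ‖star (c + (t : ℂ) • (g * c)) * (c + (t : ℂ) • (g * c))‖ ≤ C + t ^ 2 * ‖p‖ := by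
      rw [CStarRing.norm_star_mul_self, ← sq]
      calc _ ≤ ‖P.incl f * x + (t : ℂ) • P.incl (g * c)‖ ^ 2 := by gcongr
        _ = ‖star x * P.incl (star f * f) * x + ((t ^ 2 : ℝ) : ℂ) • P.incl p‖ := by
          rw [sq, ← CStarRing.norm_star_mul_self]
          congr 1
          have b1 : P.incl (star f) * P.incl g = 0 := by rw [← map_mul, hfg, map_zero]
          have b2 : P.incl g * P.incl f = 0 := by rw [← map_mul, hgf, map_zero]
          have b3 : star x * P.incl (star f) * (P.incl g * P.incl c) = 0 := by
            rw [mul_assoc, ← mul_assoc (P.incl (star f)), b1]; simp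
          have b4 : P.incl (star c) * P.incl g * (P.incl f * x) = 0 := by
            rw [mul_assoc, ← mul_assoc (P.incl g), b2]; simp
          simp only [star_add, star_mul, star_smul, ← map_star, add_mul, mul_add, smul_mul_assoc,
            mul_smul_comm, smul_smul, hp, map_mul, hgs, b3, b4, smul_zero, add_zero, zero_add]
          simp [sq, mul_assoc]
        _ ≤ _ := by
          refine (norm_add_le _ _).trans ?_
          rw [norm_smul]
          have := P.norm_incl_le p
          simp only [Complex.norm_real, Real.norm_eq_abs, abs_pow, sq_abs]
          gcongr
    have a3 : (2 * t + t ^ 2) • p ≤ star (c + (t : ℂ) • (g * c)) * (c + (t : ℂ) • (g * c)) := by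
      have b1 : star (c + (t : ℂ) • (g * c)) * (c + (t : ℂ) • (g * c))
          = star c * c + (2 * t) • (star c * g * c) + t ^ 2 • p := by
        have b0 : star (t : ℂ) = t := Complex.conj_ofReal t
        simp only [star_add, star_smul, star_mul, hgs, add_mul, mul_add, smul_mul_assoc,
            mul_smul_comm, hp, b0, mul_assoc]
        simp only [← Complex.coe_smul]
        push_cast
        module
      rw [b1, add_smul]
      gcongr
      have b2 : p ≤ star c * g * c := star_left_conjugate_le_conjugate hgg c
      calc (2 * t) • p ≤ (2 * t) • (star c * g * c) := by gcongr
        _ ≤ _ := le_add_of_nonneg_left (star_mul_self_nonneg c)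
    have a4 : (2 * t + t ^ 2) * ‖p‖ ≤ C + t ^ 2 * ‖p‖ := by
      have b1 : 0 ≤ (2 * t + t ^ 2) • p := smul_nonneg (by positivity) hp0
      have := CStarAlgebra.norm_le_norm_of_nonneg_of_le b1 a3
      rw [norm_smul, Real.norm_of_nonneg (by positivity)] at this
      exact this.trans a2
    linarith
  have hp1 : ‖p‖ = 0 := by
    by_contra hne
    have hpos : 0 < ‖p‖ := lt_of_le_of_ne (norm_nonneg _) (Ne.symm hne)
    have hC0 : 0 ≤ C := norm_nonneg _
    have := key ((C + 1) / ‖p‖) (by positivity)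
    rw [mul_assoc, div_mul_cancel₀ _ hne] at this
    linarith
  have : star (g * c) * (g * c) = 0 := by
    rw [← norm_eq_zero.1 hp1, hp, star_mul, hgs]; simp [mul_assoc]
  exact (CStarRing.star_mul_self_eq_zero_iff _).1 this


lemma exp_mul_of_selfAdjoint {b : B} (hb : IsSelfAdjoint b) (hb1 : ‖b‖ ≤ 1) (x : D) :
    P.exp (P.incl b * x) = b * P.exp x := by
  set Δ : B → B := fun f => P.exp (P.incl f * x) - f * P.exp x with hΔ
  have hΔ1 : ∀ r : ℝ, Δ (algebraMap ℝ B r) = 0 := by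
    intro r
    simp only [hΔ, Algebra.algebraMap_eq_smul_one, ← Complex.coe_smul, map_smul, map_one,
      smul_mul_assoc, one_mul, sub_self]
  have hΔs : ∀ f g, Δ (f - g) = Δ f - Δ g := by
    intro f g
    simp only [hΔ, map_sub, sub_mul]; abel
  have hΔn : ∀ f, ‖Δ f‖ ≤ 2 * ‖f‖ * ‖x‖ := by
    intro f
    have h1 : ‖P.exp (P.incl f * x)‖ ≤ ‖f‖ * ‖x‖ :=
      (P.norm_exp_le _).trans ((norm_mul_le _ _).trans (by gcongr; exact P.norm_incl_le f))
    have h2 : ‖f * P.exp x‖ ≤ ‖f‖ * ‖x‖ :=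
      (norm_mul_le _ _).trans (by gcongr; exact P.norm_exp_le x)
    calc _ ≤ _ := norm_sub_le _ _
      _ ≤ ‖f‖ * ‖x‖ + ‖f‖ * ‖x‖ := add_le_add h1 h2
      _ = _ := by ring
  have hΔ0 : ∀ {f g : B}, star f * g = 0 → 0 ≤ g → ‖g‖ ≤ 1 → g * Δ f = 0 := by
    intro f g hfg hg hg1
    have hgs : star g = g := (IsSelfAdjoint.of_nonneg hg).star_eq
    have hgf : g * f = 0 := by
      have := congrArg star hfg
      simpa [hgs] using this
    simp only [hΔ, mul_sub, P.mul_exp_eq_zero hfg hg hg1, ← mul_assoc, hgf, zero_mul, sub_zero]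
  have hspec : ∀ s ∈ spectrum ℝ b, -1 ≤ s ∧ s ≤ 1 := by
    intro s hs
    have : ‖s‖ ≤ ‖b‖ * ‖(1 : B)‖ := spectrum.norm_le_norm_mul_of_mem hs
    have h2 : |s| ≤ 1 := by
      have := this.trans (mul_le_mul hb1 (norm_one_le' B) (norm_nonneg _) zero_le_one)
      simpa using this
    exact abs_le.1 h2
  -- the estimate at scale `1 / n`
  have main : ∀ n : ℕ, 0 < n → ‖Δ b‖ ^ 2 ≤ 12 * ‖x‖ ^ 2 / n := by
    intro n hn
    have hn' : (0 : ℝ) < n := by exact_mod_cast hn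
    let c : ℕ → ℝ → ℝ := fun j s => max 0 (min 1 (n * (s + 1) - j + 1))
    let e : ℕ → ℝ → ℝ := fun j s => c j s - c (j + 1) s
    let q : ℕ → ℝ → ℝ := fun j s => √(e j s)
    let τ : ℕ → ℝ := fun j => j / n - 1
    let κ : ℕ → ℝ → ℝ := fun j s => max (-(1 / n)) (min (1 / n) (s - τ j))
    have hcc : ∀ j, Continuous (c j) := by intro j; fun_prop
    have hec : ∀ j, Continuous (e j) := by intro j; fun_prop
    have hqc : ∀ j, Continuous (q j) := fun j => (hec j).sqrt
    have hκc : ∀ j, Continuous (κ j) := by intro j; fun_prop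
    have he0 : ∀ j s, 0 ≤ e j s := by
      intro j s
      simp only [e, c, sub_nonneg]
      gcongr
      omega
    have he1 : ∀ j s, e j s ≤ 1 := by
      intro j s
      have h1 : c j s ≤ 1 := by simp [c]
      have h2 : 0 ≤ c (j + 1) s := by simp [c]
      simp only [e]; linarith
    have hsupp : ∀ j s, e j s ≠ 0 → |s - τ j| ≤ 1 / n := by
      intro j s hs
      by_contra hcon
      apply hs
      have hs' : s - τ j = (n * (s + 1) - j) / n := by simp only [τ]; field_simp; ring
      rw [hs', abs_div, abs_of_pos hn', div_le_div_iff_of_pos_right hn', not_le, lt_abs] at hcon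
      simp only [e, c]
      push_cast
      rcases hcon with h | h
      · rw [min_eq_left (by linarith), min_eq_left (by linarith), sub_self]
      · rw [max_eq_left (min_le_of_right_le (by linarith)),
          max_eq_left (min_le_of_right_le (by linarith)), sub_self]
    set Q : ℕ → B := fun j => cfc (q j) b with hQ
    have hQ0 : ∀ j, 0 ≤ Q j := fun j => cfc_nonneg (fun s _ => Real.sqrt_nonneg _)
    have hQ1 : ∀ j, ‖Q j‖ ≤ 1 := fun j => norm_cfc_le zero_le_one (fun s _ => by
      rw [Real.norm_of_nonneg (Real.sqrt_nonneg _)]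
      exact Real.sqrt_le_one.2 (he1 j s))
    have hQs : ∀ j, star (Q j) = Q j := fun j => (IsSelfAdjoint.of_nonneg (hQ0 j)).star_eq
    have hQΔ : ∀ j, ‖Q j * Δ b‖ ≤ 2 * (1 / n) * ‖x‖ := by
      intro j
      have e1 : b - algebraMap ℝ B (τ j) - cfc (κ j) b = cfc (fun s => s - τ j - κ j s) b := by
        rw [cfc_sub (fun s => s - τ j) (κ j) b, cfc_sub (fun s => s) (fun _ => τ j) b,
          cfc_id' ℝ b, cfc_const (τ j) b]
      have e2 : star (b - algebraMap ℝ B (τ j) - cfc (κ j) b) * Q j = 0 := by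
        rw [e1, ← cfc_star, hQ, ← cfc_mul _ _ b]
        rw [← cfc_zero ℝ b]
        congr 1
        funext s
        by_cases hs : e j s = 0
        · simp [q, hs]
        · have := abs_le.1 (hsupp j s hs)
          have : κ j s = s - τ j := by
            simp only [κ]
            rw [min_eq_right this.2, max_eq_right this.1]
          simp [this]
      have e3 := hΔ0 e2 (hQ0 j) (hQ1 j)
      rw [hΔs, hΔs, hΔ1, sub_zero, mul_sub, sub_eq_zero] at e3
      rw [e3]
      have e4 : ‖cfc (κ j) b‖ ≤ 1 / n := norm_cfc_le (by positivity) (fun s _ => by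
        rw [Real.norm_eq_abs, abs_le]
        exact ⟨le_max_left _ _, max_le (by have : 0 < 1 / (n : ℝ) := by positivity
                                           linarith) (min_le_left _ _)⟩)
      calc _ ≤ ‖Q j‖ * ‖Δ (cfc (κ j) b)‖ := norm_mul_le _ _
        _ ≤ 1 * (2 * ‖cfc (κ j) b‖ * ‖x‖) := by gcongr; exacts [hQ1 j, hΔn _]
        _ ≤ 2 * (1 / n) * ‖x‖ := by rw [one_mul]; gcongr
    have hsum : ∑ j ∈ Finset.range (2 * n + 1), Q j * Q j = 1 := by
      have e1 : ∀ j, Q j * Q j = cfc (e j) b := by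
        intro j
        rw [hQ, ← cfc_mul _ _ b]
        congr 1
        funext s
        exact Real.mul_self_sqrt (he0 j s)
      simp_rw [e1]
      rw [← cfc_sum (fun j => e j) b (Finset.range (2 * n + 1)) (fun j _ => (hec j).continuousOn),
        ← cfc_one ℝ b]
      refine cfc_congr fun s hs => ?_
      obtain ⟨h1, h2⟩ := hspec s hs
      simp only [Finset.sum_apply, e]
      rw [Finset.sum_range_sub']
      simp only [c]
      push_cast
      rw [min_eq_left (by nlinarith), min_eq_right (by nlinarith), max_eq_right zero_le_one,
        max_eq_left (by nlinarith)]
      simp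
    calc ‖Δ b‖ ^ 2 = ‖star (Δ b) * 1 * Δ b‖ := by
          rw [mul_one, CStarRing.norm_star_mul_self, sq]
      _ = ‖∑ j ∈ Finset.range (2 * n + 1), star (Q j * Δ b) * (Q j * Δ b)‖ := by
          rw [← hsum, Finset.mul_sum, Finset.sum_mul]
          congr 1
          refine Finset.sum_congr rfl fun j _ => ?_
          rw [star_mul, hQs]; simp only [mul_assoc]
      _ ≤ ∑ j ∈ Finset.range (2 * n + 1), (2 * (1 / n) * ‖x‖) ^ 2 := by
          refine norm_sum_le_of_le _ fun j _ => ?_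
          rw [CStarRing.norm_star_mul_self, ← sq]
          gcongr
          exact hQΔ j
      _ = (2 * n + 1) * (4 * ‖x‖ ^ 2 / (n : ℝ) ^ 2) := by
          simp only [Finset.sum_const, Finset.card_range, nsmul_eq_mul]
          push_cast
          field_simp
          ring
      _ ≤ 12 * ‖x‖ ^ 2 / n := by
          have h1 : (1 : ℝ) ≤ n := by exact_mod_cast hn
          have : (2 * (n : ℝ) + 1) * (4 * ‖x‖ ^ 2 / (n : ℝ) ^ 2)
              ≤ (3 * n) * (4 * ‖x‖ ^ 2 / (n : ℝ) ^ 2) := by gcongr; linarith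
          refine this.trans_eq ?_
          field_simp
          ring
  have h0 : ‖Δ b‖ ^ 2 ≤ 0 := by
    refine ge_of_tendsto (tendsto_const_div_atTop_nhds_zero_nat (12 * ‖x‖ ^ 2)) ?_
    filter_upwards [Filter.eventually_gt_atTop 0] with n hn using main n hn
  have : Δ b = 0 := by
    rw [← norm_eq_zero]
    exact pow_eq_zero_iff two_ne_zero |>.1 (le_antisymm h0 (by positivity))
  exact sub_eq_zero.1 this

/-- A norm-one projection is a left module map over its range. -/
lemma exp_incl_mul (b : B) (x : D) : P.exp (P.incl b * x) = b * P.exp x := by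
  have h1 : ∀ b : B, IsSelfAdjoint b → P.exp (P.incl b * x) = b * P.exp x := by
    intro b hb
    by_cases h0 : b = 0
    · simp [h0]
    have hn : ‖b‖ ≠ 0 := norm_ne_zero_iff.2 h0
    have e : b = (‖b‖ : ℂ) • (((‖b‖⁻¹ : ℝ) : ℂ) • b) := by
      rw [smul_smul, ← Complex.ofReal_mul, mul_inv_cancel₀ hn, Complex.ofReal_one, one_smul]
    have h2 := P.exp_mul_of_selfAdjoint (b := ((‖b‖⁻¹ : ℝ) : ℂ) • b)
      (by rw [Complex.coe_smul]; exact (IsSelfAdjoint.all _).smul hb)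
      (by rw [norm_smul]; simp [hn]) x
    rw [e, map_smul, smul_mul_assoc, map_smul, h2, smul_mul_assoc, smul_mul_assoc, smul_mul_assoc]
  conv_lhs => rw [← realPart_add_I_smul_imaginaryPart b]
  conv_rhs => rw [← realPart_add_I_smul_imaginaryPart b]
  rw [map_add, map_smul, add_mul, map_add, smul_mul_assoc, map_smul, h1 _ (ℜ b).2, h1 _ (ℑ b).2,
    add_mul, smul_mul_assoc]

lemma exp_mul_incl (b : B) (x : D) : P.exp (x * P.incl b) = P.exp x * b := by
  have := P.exp_incl_mul (star b) (star x)
  rw [map_star, ← star_mul, P.exp_star, P.exp_star, ← star_mul] at this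
  exact star_injective this



/-- Gram matrices over `D` are mapped by the conditional expectation to positive matrices. -/
lemma exp_gram_nonneg {N : Type*} [Fintype N] (y : N → D) (b : N → B) :
    0 ≤ ∑ k, ∑ l, star (b k) * P.exp (star (y k) * y l) * b l := by
  have h : ∑ k, ∑ l, star (b k) * P.exp (star (y k) * y l) * b l
      = P.exp (star (∑ k, y k * P.incl (b k)) * ∑ l, y l * P.incl (b l)) := by
    rw [star_sum, Finset.sum_mul, map_sum]
    refine Finset.sum_congr rfl fun k _ => ?_
    rw [Finset.mul_sum, map_sum]
    refine Finset.sum_congr rfl fun l _ => ?_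
    have e : star (y k * P.incl (b k)) * (y l * P.incl (b l))
        = P.incl (star (b k)) * ((star (y k) * y l) * P.incl (b l)) := by
      rw [star_mul, ← map_star]; simp only [mul_assoc]
    rw [e, P.exp_incl_mul, P.exp_mul_incl, mul_assoc]
  rw [h]
  exact P.exp_nonneg (star_mul_self_nonneg _)

lemma exists_jordan {X : Type*} [CStarAlgebra X] {a : X} (ha : IsSelfAdjoint a) :
    ∃ c s : X, a = star c * c - star s * s ∧ (star s * s) * (star c * c) = 0 := by
  obtain ⟨c, hc⟩ : ∃ c : X, a⁺ = star c * c :=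
    CStarAlgebra.nonneg_iff_eq_star_mul_self.1 (CFC.posPart_nonneg a)
  obtain ⟨s, hs⟩ : ∃ s : X, a⁻ = star s * s :=
    CStarAlgebra.nonneg_iff_eq_star_mul_self.1 (CFC.negPart_nonneg a)
  refine ⟨c, s, ?_, ?_⟩
  · rw [← hc, ← hs, CFC.posPart_sub_negPart a]
  · rw [← hc, ← hs, CFC.negPart_mul_posPart]

/-- A positive matrix over a C*-algebra is a Gram matrix. -/
lemma exists_gram {N : Type*} [Fintype N] (M : N → N → B)
    (hs : ∀ k l, star (M k l) = M l k)
    (hM : ∀ b : N → B, 0 ≤ ∑ k, ∑ l, star (b k) * M k l * b l) :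
    ∃ c : N → N → B, ∀ k l, M k l = ∑ m, star (c m k) * c m l := by
  classical
  let A : CStarMatrix N N B := CStarMatrix.ofMatrix (Matrix.of M)
  have hA : IsSelfAdjoint A := by
    refine CStarMatrix.ext fun k l => ?_
    rw [CStarMatrix.star_apply]
    exact hs l k
  obtain ⟨c, S, hcS, hSc⟩ := exists_jordan hA
  set n := star S * S with hn
  have hns : star n = n := by rw [hn, star_mul, star_star]
  have h1 : n * A * n = -(star (S * n) * (S * n)) := by
    rw [hcS, mul_sub, hSc, zero_sub, star_mul, hns, neg_mul]
    congr 1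
    nth_rewrite 2 [hn]
    simp only [mul_assoc]
  have h2 : ∀ k, 0 ≤ (n * A * n) k k := by
    intro k
    have := hM (fun l => n l k)
    refine this.trans_eq ?_
    rw [CStarMatrix.mul_apply, Finset.sum_comm]
    refine Finset.sum_congr rfl fun l _ => ?_
    rw [CStarMatrix.mul_apply, Finset.sum_mul]
    refine Finset.sum_congr rfl fun m _ => ?_
    have : star (n m k) = n k m := by
      rw [← CStarMatrix.star_apply, hns]
    rw [this]
    rfl
  have h3 : ∀ m k, (S * n) m k = 0 := by
    intro m k
    have e1 := h2 k
    rw [h1, CStarMatrix.neg_apply, CStarMatrix.mul_apply, neg_nonneg] at e1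
    have e2 : ∀ r ∈ Finset.univ, 0 ≤ (star (S * n)) k r * (S * n) r k := by
      intro r _
      rw [CStarMatrix.star_apply]
      exact star_mul_self_nonneg _
    have e3 := (Finset.sum_eq_zero_iff_of_nonneg e2).1
      (le_antisymm e1 (Finset.sum_nonneg e2)) m (Finset.mem_univ _)
    rw [CStarMatrix.star_apply] at e3
    exact (CStarRing.star_mul_self_eq_zero_iff _).1 e3
  have h4 : S * n = 0 := CStarMatrix.ext h3
  have h5 : n = 0 := by
    have : star n * n = 0 := by
      rw [hns]; nth_rewrite 1 [hn]; rw [mul_assoc, h4, mul_zero]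
    exact (CStarRing.star_mul_self_eq_zero_iff _).1 this
  refine ⟨fun m k => c m k, fun k l => ?_⟩
  have : M k l = (star c * c) k l := by
    rw [h5, sub_zero] at hcS
    rw [← hcS]; rfl
  rw [this, CStarMatrix.mul_apply]
  rfl

/-! ### Words and their inner products -/

variable {ι : Type*} [DecidableEq ι]

/-- A centred letter: an index together with an element of `D` of zero expectation. -/
abbrev Letter (P : CondExp D B) (ι : Type*) := ι × {a : D // P.exp a = 0}

/-- The value `exp (aₙ* ⋯ exp (a₂* exp (a₁* x c₁) c₂) ⋯ cₙ)` for two words `(i₁, a₁) ⋯ (iₙ, aₙ)` and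
`(i₁, c₁) ⋯ (iₙ, cₙ)` with the same indices, `exp x` for two empty words, and `0` for words with
different indices. It is the inner product of `a₁ ⊗ ⋯ ⊗ aₙ` and `x c₁ ⊗ ⋯ ⊗ cₙ`. -/
def kernel : List (P.Letter ι) → List (P.Letter ι) → D →ₗ[ℂ] B
  | [], [] => P.exp
  | (i, a) :: s, (j, c) :: t =>
      if i = j then
        kernel s t ∘ₗ P.incl.toAlgHom.toLinearMap ∘ₗ P.exp ∘ₗ LinearMap.mulLeft ℂ (star (a : D)) ∘ₗ
          LinearMap.mulRight ℂ (c : D)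
      else 0
  | [], _ :: _ => 0
  | _ :: _, [] => 0

@[simp] lemma kernel_nil_nil (x : D) : P.kernel ([] : List (P.Letter ι)) [] x = P.exp x := by
  simp [kernel]

@[simp] lemma kernel_cons_cons (i j : ι) (a c : {a : D // P.exp a = 0}) (s t : List (P.Letter ι))
    (x : D) : P.kernel ((i, a) :: s) ((j, c) :: t) x =
      if i = j then P.kernel s t (P.incl (P.exp (star (a : D) * (x * c)))) else 0 := by
  rw [kernel]; split_ifs <;> simp

@[simp] lemma kernel_nil_cons (p : P.Letter ι) (t : List (P.Letter ι)) (x : D) :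
    P.kernel [] (p :: t) x = 0 := by simp [kernel]

@[simp] lemma kernel_cons_nil (p : P.Letter ι) (t : List (P.Letter ι)) (x : D) :
    P.kernel (p :: t) [] x = 0 := by simp [kernel]

lemma star_kernel (s t : List (P.Letter ι)) (x : D) :
    star (P.kernel s t x) = P.kernel t s (star x) := by
  induction s generalizing t x with
  | nil => cases t with
    | nil => simp [P.exp_star]
    | cons q t => simp
  | cons p s ih => cases t with
    | nil => simp
    | cons q t =>
      obtain ⟨i, a⟩ := p
      obtain ⟨j, c⟩ := q
      rw [kernel_cons_cons, kernel_cons_cons]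
      by_cases h : i = j
      · rw [if_pos h, if_pos h.symm, ih, ← map_star, ← P.exp_star]
        simp only [star_mul, star_star, mul_assoc]
      · rw [if_neg h, if_neg (Ne.symm h), star_zero]

/-- The index of the first letter, if there is one. -/
def headIdx (s : List (P.Letter ι)) : Option ι := s.head?.map Prod.fst

/-- The first letter, or `1` for the empty word. -/
def headLet : List (P.Letter ι) → D
  | [] => 1
  | (_, a) :: _ => a

lemma kernel_eq (s t : List (P.Letter ι)) (x : D) :
    P.kernel s t x = if P.headIdx s = P.headIdx t then
      P.kernel s.tail t.tail (P.incl (P.exp (star (P.headLet s) * x * P.headLet t))) else 0 := by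
  rcases s with _ | ⟨⟨i, a⟩, s⟩ <;> rcases t with _ | ⟨⟨j, c⟩, t⟩ <;>
    simp [headIdx, headLet, P.exp_incl, mul_assoc]

universe w

lemma kernel_nonneg_aux (n : ℕ) : ∀ {N : Type w} [Fintype N] {R : Type w} [Fintype R]
    (f : N → List (P.Letter ι)) (_ : ∀ k, (f k).length ≤ n) (c : R → N → D) (b : N → B),
    0 ≤ ∑ k, ∑ l, star (b k) * P.kernel (f k) (f l) (∑ r, star (c r k) * c r l) * b l := by
  classical
  induction n with
  | zero =>
    intro N _ R _ f hf c b
    have : ∀ k, f k = [] := fun k => List.length_eq_zero_iff.1 (Nat.le_zero.1 (hf k))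
    simp only [this, kernel_nil_nil, map_sum, Finset.mul_sum, Finset.sum_mul]
    have e : ∑ k, ∑ l, ∑ r, star (b k) * P.exp (star (c r k) * c r l) * b l
        = ∑ r, ∑ k, ∑ l, star (b k) * P.exp (star (c r k) * c r l) * b l := by
      rw [Finset.sum_comm' (s := Finset.univ) (t := fun _ => Finset.univ) (t' := Finset.univ)
        (s' := fun _ => Finset.univ) (by simp)]
      rw [Finset.sum_congr rfl fun l _ => Finset.sum_comm, Finset.sum_comm]
      exact Finset.sum_congr rfl fun r _ => Finset.sum_comm
    rw [e]
    exact Finset.sum_nonneg fun r _ => P.exp_gram_nonneg (c r) b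
  | succ n ih =>
    intro N _ R _ f hf c b
    let M : N → N → B := fun k l => if P.headIdx (f k) = P.headIdx (f l) then
      P.exp (star (P.headLet (f k)) * (∑ r, star (c r k) * c r l) * P.headLet (f l)) else 0
    let O : Finset (Option ι) := Finset.univ.image fun k => P.headIdx (f k)
    let y : R → Option ι → N → D := fun r o k =>
      if P.headIdx (f k) = o then c r k * P.headLet (f k) else 0
    have hMy : ∀ k l, M k l = ∑ o ∈ O, ∑ r, P.exp (star (y r o k) * y r o l) := by
      intro k l
      have hO : P.headIdx (f k) ∈ O :=
        Finset.mem_image.2 ⟨k, Finset.mem_univ k, rfl⟩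
      rw [Finset.sum_eq_single_of_mem (P.headIdx (f k)) hO]
      · by_cases h : P.headIdx (f k) = P.headIdx (f l)
        · simp only [M, y, if_pos h, if_pos h.symm, if_true, star_mul, Finset.mul_sum,
            Finset.sum_mul, map_sum, mul_assoc]
        · simp only [M, y, if_neg h, if_neg (Ne.symm h), mul_zero, map_zero, Finset.sum_const_zero]
      · intro o _ ho
        simp [y, if_neg ho.symm]
    have hMs : ∀ k l, star (M k l) = M l k := by
      intro k l
      simp only [hMy, star_sum, ← P.exp_star, star_mul, star_star]
    have hMp : ∀ b : N → B, 0 ≤ ∑ k, ∑ l, star (b k) * M k l * b l := by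
      intro b
      have e : ∑ k, ∑ l, star (b k) * M k l * b l
          = ∑ o ∈ O, ∑ r, ∑ k, ∑ l, star (b k) * P.exp (star (y r o k) * y r o l) * b l := by
        simp only [hMy, Finset.mul_sum, Finset.sum_mul]
        rw [Finset.sum_congr rfl fun k _ => Finset.sum_comm, Finset.sum_comm]
        refine Finset.sum_congr rfl fun o _ => ?_
        rw [Finset.sum_congr rfl fun k _ => Finset.sum_comm, Finset.sum_comm]
      rw [e]
      exact Finset.sum_nonneg fun o _ => Finset.sum_nonneg fun r _ => P.exp_gram_nonneg (y r o) b
    obtain ⟨g, hg⟩ := exists_gram M hMs hMp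
    have hK : ∀ k l, P.kernel (f k) (f l) (∑ r, star (c r k) * c r l)
        = P.kernel (f k).tail (f l).tail (∑ m, star (P.incl (g m k)) * P.incl (g m l)) := by
      intro k l
      have : ∑ m, star (P.incl (g m k)) * P.incl (g m l) = P.incl (M k l) := by
        rw [hg, map_sum]; simp only [map_mul, map_star]
      rw [this, kernel_eq]
      by_cases h : P.headIdx (f k) = P.headIdx (f l)
      · simp only [M, if_pos h]
      · simp only [M, if_neg h, map_zero]
    simp only [hK]
    exact ih (fun k => (f k).tail) (fun k => by have := hf k; simp; omega)
      (fun m k => P.incl (g m k)) b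

lemma kernel_nonneg {N : Type w} [Fintype N] (f : N → List (P.Letter ι)) (c : N → D) (b : N → B) :
    0 ≤ ∑ k, ∑ l, star (b k) * P.kernel (f k) (f l) (star (c k) * c l) * b l := by
  have := P.kernel_nonneg_aux (∑ k, (f k).length) f
    (fun k => Finset.single_le_sum (f := fun k => (f k).length) (fun _ _ => Nat.zero_le _)
      (Finset.mem_univ k)) (fun (_ : PUnit.{w+1}) k => c k) b
  simpa using this


lemma exp_sub_incl (a : D) : P.exp (a - P.incl (P.exp a)) = 0 := by
  rw [map_sub, P.exp_incl, sub_self]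

/-- The centred part `a - E(a)`. -/
def ctr (a : D) : {a : D // P.exp a = 0} := ⟨a - P.incl (P.exp a), P.exp_sub_incl a⟩

/-- Reduced words: lists of centred letters whose consecutive indices are distinct. -/
def Word (P : CondExp D B) (ι : Type*) : Type _ :=
  {l : List (P.Letter ι) // l.IsChain fun p q => p.1 ≠ q.1}

/-- Every word `w` is split as `coeff i w ⊗ rest i w`, where `rest i w` does not begin with the index
`i`: if `w` begins with a letter of index `i`, then `coeff i w` is that letter and `rest i w` is
what follows; otherwise `coeff i w = 1` and `rest i w = w`. This is `rest`. -/
def rest (i : ι) : List (P.Letter ι) → List (P.Letter ι)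
  | [] => []
  | (j, c) :: t => if j = i then t else (j, c) :: t

/-- The element `coeff i w` of `D` in the splitting `w = coeff i w ⊗ rest i w`. -/
def coeff (i : ι) : List (P.Letter ι) → D
  | [] => 1
  | (j, c) :: _ => if j = i then (c : D) else 1

/-- Left multiplication by `e : B` on words: it multiplies the first letter.
On the empty word it has to be done in the coefficient, see `lcoef`. -/
def lmul (e : B) : List (P.Letter ι) → List (P.Letter ι)
  | [] => []
  | (j, c) :: t => (j, ⟨P.incl e * c, by rw [P.exp_incl_mul, c.2, mul_zero]⟩) :: t

/-- The companion of `lmul` on coefficients: left multiplication by `e` for the empty word, and the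
identity for the other ones. Thus `e · (w ⊗ b) = lmul e w ⊗ lcoef e w b`. -/
def lcoef (e : B) : List (P.Letter ι) → B →ₗ[ℂ] B
  | [] => LinearMap.mulLeft ℂ e
  | _ :: _ => LinearMap.id

lemma isChain_push (i : ι) (c : {a : D // P.exp a = 0}) {l : List (P.Letter ι)}
    (hl : l.IsChain fun p q => p.1 ≠ q.1) :
    ((i, c) :: P.rest i l).IsChain fun p q => p.1 ≠ q.1 := by
  rcases l with _ | ⟨⟨j, d⟩, t⟩
  · simp [rest]
  · by_cases h : j = i
    · subst h
      simp only [rest, if_true]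
      rcases t with _ | ⟨q, t⟩
      · simp
      · rw [List.isChain_cons_cons] at hl ⊢
        exact hl
    · simp only [rest, if_neg h]
      rw [List.isChain_cons_cons]
      exact ⟨fun h' => h h'.symm, hl⟩

lemma isChain_lmul (e : B) {l : List (P.Letter ι)} (hl : l.IsChain fun p q => p.1 ≠ q.1) :
    (P.lmul e l).IsChain fun p q => p.1 ≠ q.1 := by
  rcases l with _ | ⟨⟨j, d⟩, t⟩
  · simp [lmul]
  · rcases t with _ | ⟨q, t⟩
    · simp [lmul]
    · rw [lmul, List.isChain_cons_cons] at *
      exact hl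

lemma isChain_rest (i : ι) {l : List (P.Letter ι)} (hl : l.IsChain fun p q => p.1 ≠ q.1) :
    (P.rest i l).IsChain fun p q => p.1 ≠ q.1 :=
  (P.isChain_push i (P.ctr 0) hl).tail

lemma headIdx_rest (i : ι) {l : List (P.Letter ι)} (hl : l.IsChain fun p q => p.1 ≠ q.1) :
    P.headIdx (P.rest i l) ≠ some i := by
  have := P.isChain_push i (P.ctr 0) hl
  rcases h : P.rest i l with _ | ⟨q, t⟩
  · simp [headIdx]
  · rw [h, List.isChain_cons_cons] at this
    simpa [headIdx] using this.1.symm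

/-- The word that begins with the centred part of `a` at index `i`, followed by `rest i w`. -/
def push (i : ι) (a : D) (w : P.Word ι) : P.Word ι :=
  ⟨(i, P.ctr a) :: P.rest i w.1, P.isChain_push i _ w.2⟩

/-- The word `e · rest i w`, for `e : B`. -/
def drop (i : ι) (e : B) (w : P.Word ι) : P.Word ι :=
  ⟨P.lmul e (P.rest i w.1), P.isChain_lmul e (P.isChain_rest i w.2)⟩

/-- The free right `B`-module on the words. -/
def PreFock (P : CondExp D B) (ι : Type*) : Type _ := P.Word ι →₀ B

instance : AddCommGroup (P.PreFock ι) := inferInstanceAs (AddCommGroup (P.Word ι →₀ B))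
instance : Module ℂ (P.PreFock ι) := inferInstanceAs (Module ℂ (P.Word ι →₀ B))

/-- The element `w ⊗ b`. -/
def gen (w : P.Word ι) : B →ₗ[ℂ] P.PreFock ι := Finsupp.lsingle w

lemma preFock_ext {V : Type*} [AddCommGroup V] [Module ℂ V] {σ : ℂ →+* ℂ}
    {f g : P.PreFock ι →ₛₗ[σ] V}
    (h : ∀ w b, f (P.gen w b) = g (P.gen w b)) : f = g := by
  have : f.toAddMonoidHom = g.toAddMonoidHom :=
    Finsupp.addHom_ext (M := B) (α := P.Word ι) fun w b => h w b
  exact LinearMap.ext fun x => DFunLike.congr_fun this x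

/-- The `B`-valued semi-inner product, on finitely supported functions. -/
def rawForm : (P.Word ι →₀ B) →ₗ⋆[ℂ] (P.Word ι →₀ B) →ₗ[ℂ] B :=
  LinearMap.mk₂'ₛₗ (starRingEnd ℂ) (RingHom.id ℂ)
    (fun x y => x.sum fun w b => y.sum fun w' b' => star b * P.kernel w.1 w'.1 1 * b')
    (fun x x' y => by
      refine Finsupp.sum_add_index' (fun w => by simp [Finsupp.sum]) fun w b b' => ?_
      simp only [star_add, add_mul]
      exact Finsupp.sum_add)
    (fun z x y => by
      refine (Finsupp.sum_smul_index' (fun w => by simp [Finsupp.sum])).trans ?_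
      simp only [star_smul, smul_mul_assoc]
      rw [Finsupp.smul_sum]
      refine Finsupp.sum_congr fun w _ => ?_
      rw [Finsupp.smul_sum]; rfl)
    (fun x y y' => by
      rw [← Finsupp.sum_add]
      refine Finsupp.sum_congr fun w _ => ?_
      exact Finsupp.sum_add_index' (fun w => by simp) fun w b b' => by rw [mul_add])
    (fun z x y => by
      rw [Finsupp.smul_sum]
      refine Finsupp.sum_congr fun w _ => ?_
      refine (Finsupp.sum_smul_index' (fun w => by simp)).trans ?_
      rw [Finsupp.smul_sum]
      simp)

lemma rawForm_apply (x y : P.Word ι →₀ B) : P.rawForm x y = x.sum fun w b => y.sum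
    fun w' b' => star b * P.kernel w.1 w'.1 1 * b' := rfl

lemma rawForm_single (w w' : P.Word ι) (b b' : B) :
    P.rawForm (.single w b) (.single w' b') = star b * P.kernel w.1 w'.1 1 * b' := by
  rw [rawForm_apply]
  rw [Finsupp.sum_single_index (by simp [Finsupp.sum]), Finsupp.sum_single_index (by simp)]

lemma rawForm_self_nonneg (x : P.Word ι →₀ B) : 0 ≤ P.rawForm x x := by
  classical
  have h := P.kernel_nonneg (N := x.support) (fun w => w.1.1) (fun _ => 1) (fun w => x w.1)
  refine h.trans_eq ?_
  rw [rawForm_apply]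
  simp only [Finsupp.sum, star_one, mul_one]
  rw [← Finset.sum_coe_sort x.support]
  refine Finset.sum_congr rfl fun w _ => ?_
  rw [← Finset.sum_coe_sort x.support]

/-- The `B`-valued semi-inner product, conjugate linear in the first variable:
`⟨w ⊗ b, w' ⊗ b'⟩ = b* (kernel w w' 1) b'`. -/
def form : P.PreFock ι →ₗ⋆[ℂ] P.PreFock ι →ₗ[ℂ] B := P.rawForm

@[simp] lemma form_gen (w w' : P.Word ι) (b b' : B) :
    P.form (P.gen w b) (P.gen w' b') = star b * P.kernel w.1 w'.1 1 * b' :=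
  P.rawForm_single w w' b b'

lemma form_self_nonneg (x : P.PreFock ι) : 0 ≤ P.form x x := P.rawForm_self_nonneg x

lemma preFock_induction {p : P.PreFock ι → Prop} (hg : ∀ w b, p (P.gen w b))
    (h0 : p 0) (ha : ∀ x y, p x → p y → p (x + y)) (x : P.PreFock ι) : p x :=
  Finsupp.induction_linear (motive := p) x h0 ha hg

lemma star_form (x y : P.PreFock ι) : star (P.form x y) = P.form y x := by
  induction x using preFock_induction with
  | h0 => simp
  | ha x x' hx hx' => simp [hx, hx']
  | hg w b =>
    induction y using preFock_induction with
    | h0 => simp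
    | ha x x' hx hx' => simp [hx, hx']
    | hg w' b' => simp [star_kernel, mul_assoc]

/-! ### Right multiplication -/

/-- The right action of `B` on the module of words. -/
def rmul (b : B) : P.PreFock ι →ₗ[ℂ] P.PreFock ι :=
  Finsupp.mapRange.linearMap (LinearMap.mulRight ℂ b)

@[simp] lemma rmul_gen (b c : B) (w : P.Word ι) : P.rmul b (P.gen w c) = P.gen w (c * b) :=
  Finsupp.mapRange_single (hf := map_zero (LinearMap.mulRight ℂ b))

lemma form_rmul (x y : P.PreFock ι) (b : B) : P.form x (P.rmul b y) = P.form x y * b := by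
  induction x using preFock_induction with
  | h0 => simp
  | ha x x' hx hx' => simp [hx, hx', add_mul]
  | hg w b =>
    induction y using preFock_induction with
    | h0 => simp
    | ha x x' hx hx' => simp [hx, hx', add_mul]
    | hg w' b' => simp [mul_assoc]

lemma form_rmul_left (x y : P.PreFock ι) (b : B) :
    P.form (P.rmul b x) y = star b * P.form x y := by
  rw [← star_form, form_rmul, star_mul, star_form]

lemma form_mul_le (x y : P.PreFock ι) {c : ℝ} (hc : 0 < c) (hx : ‖P.form x x‖ ≤ c) :
    ‖P.form x y‖ ^ 2 ≤ c * ‖P.form y y‖ := by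
  set b := P.form x y with hb
  have h := P.form_self_nonneg (P.rmul (((c⁻¹ : ℝ) : ℂ) • b) x - y)
  have hs : P.form y x = star b := by rw [hb, star_form]
  have e : P.form (P.rmul (((c⁻¹ : ℝ) : ℂ) • b) x - y) (P.rmul (((c⁻¹ : ℝ) : ℂ) • b) x - y)
      = (c⁻¹ ^ 2) • (star b * P.form x x * b) - (2 * c⁻¹) • (star b * b) + P.form y y := by
    have b0 : star (((c⁻¹ : ℝ) : ℂ)) = ((c⁻¹ : ℝ) : ℂ) := Complex.conj_ofReal _
    simp only [map_sub, LinearMap.sub_apply, form_rmul, form_rmul_left, hs, ← hb, star_smul, b0,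
      smul_mul_assoc, mul_smul_comm]
    simp only [← Complex.coe_smul]
    push_cast
    module
  rw [e] at h
  have h1 : star b * P.form x x * b ≤ c • (star b * b) := by
    have h2 : P.form x x ≤ algebraMap ℝ B c :=
      (CStarAlgebra.norm_le_iff_le_algebraMap _ hc.le (P.form_self_nonneg x)).1 hx
    have := star_left_conjugate_le_conjugate h2 b
    rwa [Algebra.algebraMap_eq_smul_one, mul_smul_comm, mul_one, smul_mul_assoc] at this
  have h2 : c⁻¹ • (star b * b) ≤ P.form y y := by
    have h3 : (c⁻¹ ^ 2) • (star b * P.form x x * b) ≤ c⁻¹ • (star b * b) := by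
      have := smul_le_smul_of_nonneg_left h1 (show 0 ≤ c⁻¹ ^ 2 by positivity)
      rwa [smul_smul, show c⁻¹ ^ 2 * c = c⁻¹ by field_simp] at this
    have h4 := h.trans (add_le_add_left (sub_le_sub_right h3 _) _)
    have h5 : c⁻¹ • (star b * b) - (2 * c⁻¹) • (star b * b) + P.form y y
        = P.form y y - c⁻¹ • (star b * b) := by module
    rw [h5] at h4
    exact sub_nonneg.1 h4
  have h3 := CStarAlgebra.norm_le_norm_of_nonneg_of_le
    (smul_nonneg (inv_nonneg.2 hc.le) (star_mul_self_nonneg b)) h2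
  rw [norm_smul, CStarRing.norm_star_mul_self, Real.norm_of_nonneg (by positivity)] at h3
  calc ‖b‖ ^ 2 = c * (c⁻¹ * (‖b‖ * ‖b‖)) := by field_simp
    _ ≤ _ := by gcongr

lemma norm_form_le_aux (x y : P.PreFock ι) :
    ‖P.form x y‖ ≤ √‖P.form x x‖ * √‖P.form y y‖ := by
  rw [← Real.sqrt_mul (norm_nonneg _)]
  refine Real.le_sqrt_of_sq_le ?_
  have h : Filter.Tendsto (fun ε : ℝ => (‖P.form x x‖ + ε) * ‖P.form y y‖)
      (nhdsWithin 0 (Set.Ioi 0)) (nhds (‖P.form x x‖ * ‖P.form y y‖)) := by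
    have : Continuous (fun ε : ℝ => (‖P.form x x‖ + ε) * ‖P.form y y‖) := by fun_prop
    have h3 := (this.tendsto 0).mono_left (nhdsWithin_le_nhds (s := Set.Ioi 0))
    simpa using h3
  refine ge_of_tendsto h ?_
  filter_upwards [self_mem_nhdsWithin] with ε hε
  have : (0 : ℝ) < ε := hε
  exact P.form_mul_le x y (by positivity) (by linarith)

/-- The seminorm `‖x‖ = ‖⟨x, x⟩‖^{1/2}`. -/
instance : Norm (P.PreFock ι) := ⟨fun x => √‖P.form x x‖⟩

lemma norm_def (x : P.PreFock ι) : ‖x‖ = √‖P.form x x‖ := rfl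

lemma norm_sq (x : P.PreFock ι) : ‖x‖ ^ 2 = ‖P.form x x‖ := Real.sq_sqrt (norm_nonneg _)

lemma norm_form_le (x y : P.PreFock ι) : ‖P.form x y‖ ≤ ‖x‖ * ‖y‖ := P.norm_form_le_aux x y

lemma preFockCore (P : CondExp D B) (ι : Type*) [DecidableEq ι] :
    SeminormedSpace.Core ℂ (P.PreFock ι) where
  norm_nonneg x := Real.sqrt_nonneg _
  norm_smul c x := by
    simp only [norm_def, map_smulₛₗ, LinearMap.smul_apply, norm_smul, RingHom.id_apply,
      RCLike.norm_conj]
    rw [← mul_assoc, ← sq, Real.sqrt_mul (sq_nonneg _), Real.sqrt_sq (norm_nonneg _)]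
  norm_triangle x y := by
    have h0 : ∀ z : P.PreFock ι, 0 ≤ ‖z‖ := fun z => Real.sqrt_nonneg _
    refine abs_le_of_sq_le_sq' ?_ (add_nonneg (h0 x) (h0 y)) |>.2
    rw [norm_sq]
    simp only [map_add, LinearMap.add_apply]
    calc _ ≤ ‖P.form x x‖ + ‖P.form y x‖ + (‖P.form x y‖ + ‖P.form y y‖) :=
          (norm_add_le _ _).trans (add_le_add (norm_add_le _ _) (norm_add_le _ _))
      _ ≤ ‖x‖ ^ 2 + ‖y‖ * ‖x‖ + (‖x‖ * ‖y‖ + ‖y‖ ^ 2) := by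
          rw [← norm_sq, ← norm_sq]
          gcongr <;> exact P.norm_form_le _ _
      _ = _ := by ring

instance : SeminormedAddCommGroup (P.PreFock ι) := .ofCore (P.preFockCore ι)
instance : NormedSpace ℂ (P.PreFock ι) where
  norm_smul_le c x := ((P.preFockCore ι).norm_smul c x).le

/-! ### The left actions -/

/-- The left action of `a : D` with index `i` on words: with `w = d ⊗ w'`, where `d = coeff i w` and
`w' = rest i w`, it is `w ⊗ b ↦ (a d - exp (a d)) ⊗ w' ⊗ b + exp (a d) · (w' ⊗ b)`. -/
def pre (i : ι) (a : D) : P.PreFock ι →ₗ[ℂ] P.PreFock ι :=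
  Finsupp.lsum ℂ fun w : P.Word ι =>
    P.gen (P.push i (a * P.coeff i w.1) w) +
      P.gen (P.drop i (P.exp (a * P.coeff i w.1)) w) ∘ₗ
        P.lcoef (P.exp (a * P.coeff i w.1)) (P.rest i w.1)

lemma pre_gen (i : ι) (a : D) (w : P.Word ι) (b : B) :
    P.pre i a (P.gen w b) = P.gen (P.push i (a * P.coeff i w.1) w) b +
      P.gen (P.drop i (P.exp (a * P.coeff i w.1)) w)
        (P.lcoef (P.exp (a * P.coeff i w.1)) (P.rest i w.1) b) :=
  Finsupp.lsum_single _ _ _ _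

lemma kernel_lmul (e : B) (s t : List (P.Letter ι)) (x : D) (b : B) :
    P.kernel s (P.lmul e t) x * P.lcoef e t b = P.kernel s t (x * P.incl e) * b := by
  rcases s with _ | ⟨⟨i, c⟩, s⟩ <;> rcases t with _ | ⟨⟨j, d⟩, t⟩ <;>
    simp [lmul, lcoef, P.exp_mul_incl, mul_assoc]

lemma lmul_kernel (e : B) (s t : List (P.Letter ι)) (x : D) (b : B) :
    star (P.lcoef e s b) * P.kernel (P.lmul e s) t x
      = star b * P.kernel s t (P.incl (star e) * x) := by
  have h := congrArg star (P.kernel_lmul e t s (star x) b)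
  simp only [star_mul, star_kernel, star_star] at h
  rw [h, map_star]

lemma headIdx_lmul (e : B) (s : List (P.Letter ι)) : P.headIdx (P.lmul e s) = P.headIdx s := by
  rcases s with _ | ⟨⟨i, c⟩, s⟩ <;> simp [headIdx, lmul]

lemma kernel_of_headIdx_ne {s t : List (P.Letter ι)} (h : P.headIdx s ≠ P.headIdx t) (x : D) :
    P.kernel s t x = 0 := by rw [kernel_eq, if_neg h]

lemma rest_of_headIdx_ne {i : ι} {s : List (P.Letter ι)} (h : P.headIdx s ≠ some i) :
    P.rest i s = s ∧ P.coeff i s = 1 := by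
  rcases s with _ | ⟨⟨j, c⟩, s⟩
  · simp [rest, coeff]
  · have : j ≠ i := by simpa [headIdx] using h
    simp [rest, coeff, this]

lemma exp_mul_ctr (c d : D) (hc : P.exp c = 0) :
    P.exp (c * (d - P.incl (P.exp d))) = P.exp (c * d) := by
  rw [mul_sub, map_sub, P.exp_mul_incl, hc, zero_mul, sub_zero]

lemma form_gen_pre (i : ι) (a : D) (w w' : P.Word ι) (b b' : B) :
    P.form (P.gen w b) (P.pre i a (P.gen w' b')) =
      star b * P.kernel (P.rest i w.1) (P.rest i w'.1)
        (P.incl (P.exp (star (P.coeff i w.1) * (a * P.coeff i w'.1)))) * b' := by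
  have hr := P.headIdx_rest i w'.2
  rw [pre_gen, map_add, form_gen, form_gen]
  simp only [push, drop]
  generalize w.1 = s
  generalize w'.1 = s' at hr ⊢
  set d := a * P.coeff i s'
  set r := P.rest i s'
  rw [mul_assoc (star b) (P.kernel s (P.lmul _ _) 1), kernel_lmul]
  by_cases h : P.headIdx s = some i
  · rcases s with _ | ⟨⟨j, c⟩, t⟩
    · simp [headIdx] at h
    · have hj : j = i := by simpa [headIdx] using h
      subst hj
      have h1 : P.headIdx ((j, c) :: t) ≠ P.headIdx r := by rw [h]; exact hr.symm
      have hc : P.exp (star (c : D)) = 0 := by rw [P.exp_star, c.2, star_zero]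
      rw [P.kernel_of_headIdx_ne h1]
      simp [rest, coeff, ctr, P.exp_mul_ctr _ _ hc]
  · obtain ⟨h1, h2⟩ := P.rest_of_headIdx_ne h
    rw [h1, h2, P.kernel_of_headIdx_ne (by simpa [headIdx] using h)]
    simp [mul_assoc]

lemma form_pre_pre (i : ι) (a c : D) (x y : P.PreFock ι) :
    P.form (P.pre i a x) (P.pre i c y) = P.form x (P.pre i (star a * c) y) := by
  induction x using preFock_induction with
  | h0 => simp
  | ha x x' hx hx' => simp [hx, hx']
  | hg w b =>
    induction y using preFock_induction with
    | h0 => simp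
    | ha x x' hx hx' => simp [hx, hx']
    | hg w' b' =>
      have hr := P.headIdx_rest i w.2
      have hp : P.rest i (P.push i (a * P.coeff i w.1) w).1 = P.rest i w.1 ∧
          P.coeff i (P.push i (a * P.coeff i w.1) w).1 = P.ctr (a * P.coeff i w.1) := by
        simp [push, rest, coeff]
      have hd : P.headIdx (P.drop i (P.exp (a * P.coeff i w.1)) w).1 ≠ some i := by
        simp only [drop, headIdx_lmul]; exact hr
      rw [pre_gen P i a, map_add, LinearMap.add_apply, form_gen_pre, form_gen_pre, form_gen_pre,
        hp.1, hp.2, (P.rest_of_headIdx_ne hd).1, (P.rest_of_headIdx_ne hd).2]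
      simp only [drop]
      rw [lmul_kernel, ← add_mul, ← mul_add, ← map_add, ← map_mul, ← map_add]
      congr 4
      simp only [ctr, star_one, one_mul, star_sub, sub_mul, map_sub, ← map_star, P.exp_incl_mul,
        star_mul, mul_assoc, sub_add_cancel]

lemma kernel_rest (i : ι) (s t : List (P.Letter ι)) (b : B) :
    P.kernel (P.rest i s) (P.rest i t)
      (P.incl (P.exp (star (P.coeff i s) * (P.incl b * P.coeff i t))))
      = P.kernel s t (P.incl b) := by
  by_cases h : P.headIdx s = some i <;> by_cases h' : P.headIdx t = some i
  · rw [kernel_eq P s t, if_pos (h.trans h'.symm)]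
    rcases s with _ | ⟨⟨j, c⟩, s⟩
    · simp [headIdx] at h
    rcases t with _ | ⟨⟨k, d⟩, t⟩
    · simp [headIdx] at h'
    have hj : j = i := by simpa [headIdx] using h
    have hk : k = i := by simpa [headIdx] using h'
    subst hj
    subst hk
    simp [rest, coeff, headLet, mul_assoc]
  · obtain ⟨h1, h2⟩ := P.rest_of_headIdx_ne h'
    rw [h1, h2, P.kernel_of_headIdx_ne (s := s) (by rw [h]; exact Ne.symm h')]
    rcases s with _ | ⟨⟨j, c⟩, s⟩
    · simp [headIdx] at h
    have hj : j = i := by simpa [headIdx] using h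
    subst hj
    simp [coeff, P.exp_mul_incl, P.exp_star, c.2]
  · obtain ⟨h1, h2⟩ := P.rest_of_headIdx_ne h
    rw [h1, h2, P.kernel_of_headIdx_ne (s := s) (t := t) (by rw [h']; exact h)]
    rcases t with _ | ⟨⟨j, c⟩, t⟩
    · simp [headIdx] at h'
    have hj : j = i := by simpa [headIdx] using h'
    subst hj
    simp [coeff, P.exp_incl_mul, c.2]
  · obtain ⟨h1, h2⟩ := P.rest_of_headIdx_ne h
    obtain ⟨h3, h4⟩ := P.rest_of_headIdx_ne h'
    simp [h1, h2, h3, h4, P.exp_incl]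

/-- On `B` all the left actions agree. -/
lemma form_gen_pre_incl (i : ι) (e : B) (w w' : P.Word ι) (b b' : B) :
    P.form (P.gen w b) (P.pre i (P.incl e) (P.gen w' b')) =
      star b * P.kernel w.1 w'.1 (P.incl e) * b' := by
  rw [form_gen_pre, kernel_rest]

lemma form_pre_incl (i j : ι) (e : B) (x y : P.PreFock ι) :
    P.form x (P.pre i (P.incl e) y) = P.form x (P.pre j (P.incl e) y) := by
  induction x using preFock_induction with
  | h0 => simp
  | ha x x' hx hx' => simp [hx, hx']
  | hg w b =>
    induction y using preFock_induction with
    | h0 => simp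
    | ha x x' hx hx' => simp [hx, hx']
    | hg w' b' => rw [form_gen_pre_incl, form_gen_pre_incl]

lemma form_pre_one (i : ι) (x y : P.PreFock ι) : P.form x (P.pre i 1 y) = P.form x y := by
  induction x using preFock_induction with
  | h0 => simp
  | ha x x' hx hx' => simp [hx, hx']
  | hg w b =>
    induction y using preFock_induction with
    | h0 => simp
    | ha x x' hx hx' => simp [hx, hx']
    | hg w' b' => rw [← map_one P.incl, form_gen_pre_incl, form_gen, map_one]

lemma form_pre_left (i : ι) (a : D) (x y : P.PreFock ι) :
    P.form (P.pre i a x) y = P.form x (P.pre i (star a) y) := by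
  rw [← P.form_pre_one i (P.pre i a x) y, form_pre_pre, mul_one]

lemma form_pre_mul (i : ι) (a c : D) (x y : P.PreFock ι) :
    P.form x (P.pre i a (P.pre i c y)) = P.form x (P.pre i (a * c) y) := by
  have := P.form_pre_left i (star a) x (P.pre i c y)
  rw [star_star] at this
  rw [← this, form_pre_pre, star_star]

lemma form_pre_add (i : ι) (a c : D) (x y : P.PreFock ι) :
    P.form x (P.pre i (a + c) y) = P.form x (P.pre i a y) + P.form x (P.pre i c y) := by
  induction x using preFock_induction with
  | h0 => simp
  | ha x x' hx hx' => simp only [map_add, LinearMap.add_apply, hx, hx']; abel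
  | hg w b =>
    induction y using preFock_induction with
    | h0 => simp
    | ha x x' hx hx' => simp only [map_add, hx, hx']; abel
    | hg w' b' => simp only [form_gen_pre, mul_add, add_mul, map_add]

lemma form_pre_smul (i : ι) (z : ℂ) (a : D) (x y : P.PreFock ι) :
    P.form x (P.pre i (z • a) y) = z • P.form x (P.pre i a y) := by
  induction x using preFock_induction with
  | h0 => simp
  | ha x x' hx hx' => simp only [map_add, LinearMap.add_apply, hx, hx', smul_add]
  | hg w b =>
    induction y using preFock_induction with
    | h0 => simp
    | ha x x' hx hx' => simp only [map_add, hx, hx', smul_add]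
    | hg w' b' => simp only [form_gen_pre, mul_smul_comm, smul_mul_assoc, map_smul]

lemma norm_pre_le (i : ι) (a : D) (x : P.PreFock ι) : ‖P.pre i a x‖ ≤ ‖a‖ * ‖x‖ := by
  obtain ⟨c, hc⟩ : ∃ c : D, algebraMap ℝ D (‖a‖ ^ 2) - star a * a = star c * c :=
    CStarAlgebra.nonneg_iff_eq_star_mul_self.1
      (sub_nonneg.2 CStarAlgebra.star_mul_le_algebraMap_norm_sq)
  have h1 : P.form (P.pre i c x) (P.pre i c x)
      = (‖a‖ ^ 2) • P.form x x - P.form (P.pre i a x) (P.pre i a x) := by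
    have e : star c * c = ((‖a‖ ^ 2 : ℝ) : ℂ) • (1 : D) + (-1 : ℂ) • (star a * a) := by
      rw [← hc, Algebra.algebraMap_eq_smul_one, Complex.coe_smul]; module
    rw [form_pre_pre, e, form_pre_add, form_pre_smul, form_pre_smul, form_pre_one, form_pre_pre,
      Complex.coe_smul]
    module
  have h2 : P.form (P.pre i a x) (P.pre i a x) ≤ (‖a‖ ^ 2) • P.form x x :=
    sub_nonneg.1 (h1 ▸ P.form_self_nonneg (P.pre i c x))
  have h3 := CStarAlgebra.norm_le_norm_of_nonneg_of_le (P.form_self_nonneg _) h2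
  rw [norm_smul, ← norm_sq, ← norm_sq, Real.norm_of_nonneg (by positivity), ← mul_pow] at h3
  exact abs_le_of_sq_le_sq' h3 (by positivity) |>.2

/-! ### The Hilbert module -/

open UniformSpace

/-- The Hilbert module: the separated completion of the module of words. -/
def Fock (P : CondExp D B) (ι : Type*) [DecidableEq ι] : Type _ := Completion (P.PreFock ι)

instance : NormedAddCommGroup (P.Fock ι) :=
  inferInstanceAs (NormedAddCommGroup (Completion (P.PreFock ι)))
instance : NormedSpace ℂ (P.Fock ι) :=
  inferInstanceAs (NormedSpace ℂ (Completion (P.PreFock ι)))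
instance : CompleteSpace (P.Fock ι) :=
  inferInstanceAs (CompleteSpace (Completion (P.PreFock ι)))

/-- The canonical map from the module of words. -/
def toFock : P.PreFock ι →L[ℂ] P.Fock ι :=
  (Completion.toComplL : P.PreFock ι →L[ℂ] Completion (P.PreFock ι))

lemma isDenseInducing_toFock : IsDenseInducing (P.toFock : P.PreFock ι → P.Fock ι) :=
  Completion.isDenseInducing_coe (α := P.PreFock ι)

@[simp] lemma norm_toFock (x : P.PreFock ι) : ‖P.toFock x‖ = ‖x‖ := Completion.norm_coe x

lemma fock_induction {p : P.Fock ι → Prop} (x : P.Fock ι) (hp : IsClosed {x | p x})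
    (h : ∀ x, p (P.toFock x)) : p x :=
  P.isDenseInducing_toFock.dense.induction_on x hp h

lemma fock_induction₂ {p : P.Fock ι → P.Fock ι → Prop} (x y : P.Fock ι)
    (hp : IsClosed {q : P.Fock ι × P.Fock ι | p q.1 q.2})
    (h : ∀ x y, p (P.toFock x) (P.toFock y)) : p x y :=
  P.isDenseInducing_toFock.dense.induction_on₂ hp h x y

lemma fock_induction₃ {p : P.Fock ι → P.Fock ι → P.Fock ι → Prop} (x y z : P.Fock ι)
    (hp : IsClosed {q : P.Fock ι × P.Fock ι × P.Fock ι | p q.1 q.2.1 q.2.2})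
    (h : ∀ x y z, p (P.toFock x) (P.toFock y) (P.toFock z)) : p x y z :=
  P.isDenseInducing_toFock.dense.induction_on₃ hp h x y z

/-- The extension of a bounded operator on the module of words to the Hilbert module. -/
def extend (T : P.PreFock ι →L[ℂ] P.PreFock ι) : P.Fock ι →L[ℂ] P.Fock ι :=
  (T.completion : Completion (P.PreFock ι) →L[ℂ] Completion (P.PreFock ι))

@[simp] lemma extend_toFock (T : P.PreFock ι →L[ℂ] P.PreFock ι) (x : P.PreFock ι) :
    P.extend T (P.toFock x) = P.toFock (T x) :=
  Completion.map_coe T.uniformContinuous x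

/-- The semi-inner product as a bounded sesquilinear map. -/
def formL : P.PreFock ι →L⋆[ℂ] P.PreFock ι →L[ℂ] B :=
  P.form.mkContinuous₂ 1 fun x y => by rw [one_mul]; exact P.norm_form_le x y

lemma continuous_form : Continuous fun p : P.PreFock ι × P.PreFock ι => P.form p.1 p.2 := by
  have : Continuous fun p : P.PreFock ι × P.PreFock ι => P.formL p.1 p.2 := by fun_prop
  exact this

/-- The `B`-valued inner product of the Hilbert module, conjugate linear in the first variable. -/
def ip (x y : P.Fock ι) : B :=
  (P.isDenseInducing_toFock.prodMap P.isDenseInducing_toFock).extend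
    (fun p : P.PreFock ι × P.PreFock ι => P.form p.1 p.2) (x, y)

@[simp] lemma ip_toFock (x y : P.PreFock ι) : P.ip (P.toFock x) (P.toFock y) = P.form x y :=
  (P.isDenseInducing_toFock.prodMap P.isDenseInducing_toFock).extend_eq P.continuous_form (x, y)

lemma continuous_ip : Continuous fun p : P.Fock ι × P.Fock ι => P.ip p.1 p.2 := by
  let f : P.PreFock ι →+ P.PreFock ι →+ B :=
    { toFun := fun x => (P.form x).toAddMonoidHom
      map_zero' := by ext x; simp
      map_add' := fun x y => by ext z; simp }
  have : Continuous fun p : P.PreFock ι × P.PreFock ι => f p.1 p.2 := P.continuous_form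
  exact (Completion.isDenseInducing_toCompl (P.PreFock ι)).extend_Z_bilin
    (Completion.isDenseInducing_toCompl (P.PreFock ι)) this

@[fun_prop] lemma _root_.Continuous.fock_ip {X : Type*} [TopologicalSpace X] {f g : X → P.Fock ι}
    (hf : Continuous f) (hg : Continuous g) : Continuous fun x => P.ip (f x) (g x) :=
  P.continuous_ip.comp (hf.prodMk hg)

lemma star_ip (x y : P.Fock ι) : star (P.ip x y) = P.ip y x :=
  P.fock_induction₂ (p := fun x y => star (P.ip x y) = P.ip y x) x y
    (isClosed_eq (by fun_prop) (by fun_prop)) fun a b => by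
    simp only [ip_toFock, star_form]

lemma ip_add (x y z : P.Fock ι) : P.ip x (y + z) = P.ip x y + P.ip x z :=
  P.fock_induction₃ (p := fun x y z => P.ip x (y + z) = P.ip x y + P.ip x z) x y z
    (isClosed_eq (by fun_prop) (by fun_prop)) fun a b c => by
    simp only [← map_add, ip_toFock]

lemma ip_smul (z : ℂ) (x y : P.Fock ι) : P.ip x (z • y) = z • P.ip x y :=
  P.fock_induction₂ (p := fun x y => P.ip x (z • y) = z • P.ip x y) x y
    (isClosed_eq
      (Continuous.fock_ip (P := P) continuous_fst (continuous_snd.const_smul z))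
      (P.continuous_ip.const_smul z)) fun a b => by
    rw [← map_smul, ip_toFock, ip_toFock, map_smul]

lemma norm_ip_self (x : P.Fock ι) : ‖P.ip x x‖ = ‖x‖ ^ 2 :=
  P.fock_induction (p := fun x => ‖P.ip x x‖ = ‖x‖ ^ 2) x
    (isClosed_eq (by fun_prop) (by fun_prop)) fun a => by
    simp only [ip_toFock, norm_toFock, norm_sq]

lemma ip_self_nonneg (x : P.Fock ι) : 0 ≤ P.ip x x :=
  P.fock_induction (p := fun x => 0 ≤ P.ip x x) x
    (isClosed_le (by fun_prop) (by fun_prop)) fun a => by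
    simp only [ip_toFock, form_self_nonneg]

lemma norm_ip_le (x y : P.Fock ι) : ‖P.ip x y‖ ≤ ‖x‖ * ‖y‖ :=
  P.fock_induction₂ (p := fun x y => ‖P.ip x y‖ ≤ ‖x‖ * ‖y‖) x y
    (isClosed_le (by fun_prop) (by fun_prop)) fun a b => by
    simp only [ip_toFock, norm_toFock, norm_form_le]

lemma ip_sub (x y z : P.Fock ι) : P.ip x (y - z) = P.ip x y - P.ip x z := by
  have := P.ip_add x (y - z) z
  rw [sub_add_cancel] at this
  rw [this, add_sub_cancel_right]

lemma add_ip (x y z : P.Fock ι) : P.ip (x + y) z = P.ip x z + P.ip y z := by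
  rw [← star_ip, ip_add, star_add, star_ip, star_ip]

lemma smul_ip (z : ℂ) (x y : P.Fock ι) : P.ip (z • x) y = star z • P.ip x y := by
  rw [← star_ip, ip_smul, star_smul, star_ip]

lemma eq_of_ip {y z : P.Fock ι} (h : ∀ x, P.ip x y = P.ip x z) : y = z := by
  have h1 : P.ip (y - z) (y - z) = 0 := by rw [ip_sub, h, sub_self]
  have h2 := P.norm_ip_self (y - z)
  rw [h1, norm_zero] at h2
  exact sub_eq_zero.1 (norm_eq_zero.1 (pow_eq_zero_iff two_ne_zero |>.1 h2.symm))

lemma norm_rmul_le (b : B) (x : P.PreFock ι) : ‖P.rmul b x‖ ≤ ‖b‖ * ‖x‖ := by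
  refine abs_le_of_sq_le_sq' ?_ (by positivity) |>.2
  rw [norm_sq, form_rmul, form_rmul_left, mul_pow, norm_sq]
  calc _ ≤ ‖star b‖ * ‖P.form x x‖ * ‖b‖ :=
        (norm_mul_le _ _).trans (by gcongr; exact norm_mul_le _ _)
    _ = _ := by rw [norm_star]; ring

/-- The right action of `B` on the Hilbert module. -/
def rightMul (b : B) : P.Fock ι →L[ℂ] P.Fock ι :=
  P.extend (LinearMap.mkContinuous
    { toFun := fun x => P.rmul b x
      map_add' := fun x y => map_add (P.rmul b) x y
      map_smul' := fun z x => map_smul (P.rmul b) z x } ‖b‖ (P.norm_rmul_le b))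

@[simp] lemma rightMul_toFock (b : B) (x : P.PreFock ι) :
    P.rightMul b (P.toFock x) = P.toFock (P.rmul b x) :=
  P.extend_toFock _ x

lemma ip_rightMul (x y : P.Fock ι) (b : B) : P.ip x (P.rightMul b y) = P.ip x y * b :=
  P.fock_induction₂ (p := fun x y => P.ip x (P.rightMul b y) = P.ip x y * b) x y
    (isClosed_eq (Continuous.fock_ip (P := P) continuous_fst
      ((P.rightMul b).continuous.comp continuous_snd))
      (P.continuous_ip.mul continuous_const)) fun x y => by
    simp only [rightMul_toFock, ip_toFock, form_rmul]

/-- `S` is an adjoint of `T` for the `B`-valued inner product. -/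
def IsAdj (T S : P.Fock ι →L[ℂ] P.Fock ι) : Prop := ∀ x y, P.ip (T x) y = P.ip x (S y)

variable {P}

lemma IsAdj.symm {T S : P.Fock ι →L[ℂ] P.Fock ι} (h : P.IsAdj T S) : P.IsAdj S T := fun x y => by
  rw [← star_ip, ← h, star_ip]

lemma IsAdj.unique {T S S' : P.Fock ι →L[ℂ] P.Fock ι} (h : P.IsAdj T S) (h' : P.IsAdj T S') :
    S = S' :=
  ContinuousLinearMap.ext fun y => P.eq_of_ip fun x => by rw [← h, ← h']

/-- Adjointable operators are `B`-linear. -/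
lemma IsAdj.map_rightMul {T S : P.Fock ι →L[ℂ] P.Fock ι} (h : P.IsAdj T S) (b : B)
    (x : P.Fock ι) : T (P.rightMul b x) = P.rightMul b (T x) :=
  P.eq_of_ip fun y => by rw [← h.symm, ip_rightMul, ip_rightMul, h.symm]

lemma IsAdj.norm_le {T S : P.Fock ι →L[ℂ] P.Fock ι} (h : P.IsAdj T S) : ‖S‖ ≤ ‖T‖ := by
  refine S.opNorm_le_bound (norm_nonneg _) fun y => ?_
  by_cases h0 : ‖S y‖ = 0
  · rw [h0]; positivity
  have h1 : ‖S y‖ * ‖S y‖ ≤ (‖T‖ * ‖y‖) * ‖S y‖ := by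
    rw [← sq, ← norm_ip_self, ← h]
    calc _ ≤ ‖T (S y)‖ * ‖y‖ := P.norm_ip_le _ _
      _ ≤ ‖T‖ * ‖S y‖ * ‖y‖ := by gcongr; exact T.le_opNorm _
      _ = _ := by ring
  exact le_of_mul_le_mul_right h1 (lt_of_le_of_ne (norm_nonneg _) (Ne.symm h0))

lemma IsAdj.one : P.IsAdj (1 : P.Fock ι →L[ℂ] P.Fock ι) 1 := fun _ _ => rfl

lemma IsAdj.add {T S T' S' : P.Fock ι →L[ℂ] P.Fock ι} (h : P.IsAdj T S) (h' : P.IsAdj T' S') :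
    P.IsAdj (T + T') (S + S') := fun x y => by
  simp only [add_apply, add_ip, ip_add, h x y, h' x y]

lemma IsAdj.smul {T S : P.Fock ι →L[ℂ] P.Fock ι} (h : P.IsAdj T S) (z : ℂ) :
    P.IsAdj (z • T) (star z • S) := fun x y => by
  simp only [smul_apply, smul_ip, ip_smul, h x y]

lemma IsAdj.mul {T S T' S' : P.Fock ι →L[ℂ] P.Fock ι} (h : P.IsAdj T S) (h' : P.IsAdj T' S') :
    P.IsAdj (T * T') (S' * S) := fun x y => by
  simp only [mul_apply_eq_comp, h _ y, h' x _]

variable (P) in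
/-- The algebra of adjointable operators on the Hilbert module, with the operator norm. -/
def adjointable (ι : Type*) [DecidableEq ι] : Subalgebra ℂ (P.Fock ι →L[ℂ] P.Fock ι) where
  carrier := {T | ∃ S, P.IsAdj T S}
  mul_mem' := fun ⟨_, h⟩ ⟨_, h'⟩ => ⟨_, h.mul h'⟩
  add_mem' := fun ⟨_, h⟩ ⟨_, h'⟩ => ⟨_, h.add h'⟩
  algebraMap_mem' z := ⟨_, by
    rw [Algebra.algebraMap_eq_smul_one]; exact IsAdj.one.smul z⟩

instance : Star (P.adjointable ι) := ⟨fun T => ⟨T.2.choose, T.1, T.2.choose_spec.symm⟩⟩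

lemma isAdj_star (T : P.adjointable ι) : P.IsAdj T.1 (star T).1 := T.2.choose_spec

lemma star_eq_of_isAdj {T S : P.adjointable ι} (h : P.IsAdj T.1 S.1) : star T = S :=
  Subtype.ext ((isAdj_star T).unique h)

instance : StarRing (P.adjointable ι) where
  star_involutive T := star_eq_of_isAdj (isAdj_star T).symm
  star_mul T S := star_eq_of_isAdj ((isAdj_star T).mul (isAdj_star S))
  star_add T S := star_eq_of_isAdj ((isAdj_star T).add (isAdj_star S))

instance : StarModule ℂ (P.adjointable ι) where
  star_smul z T := star_eq_of_isAdj ((isAdj_star T).smul z)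

instance : CStarRing (P.adjointable ι) where
  norm_mul_self_le T := by
    have h : ∀ x, ‖T.1 x‖ ≤ √‖star T * T‖ * ‖x‖ := by
      intro x
      refine abs_le_of_sq_le_sq' ?_ (by positivity) |>.2
      have e : √‖star T * T‖ ^ 2 = ‖star T * T‖ := Real.sq_sqrt (norm_nonneg _)
      rw [mul_pow, e, ← norm_ip_self, isAdj_star T]
      calc _ ≤ ‖x‖ * ‖(star T * T).1 x‖ := P.norm_ip_le _ _
        _ ≤ ‖x‖ * (‖star T * T‖ * ‖x‖) := by gcongr; exact (star T * T).1.le_opNorm x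
        _ = _ := by ring
    have h2 : ‖T‖ ≤ √‖star T * T‖ := T.1.opNorm_le_bound (Real.sqrt_nonneg _) h
    calc ‖T‖ * ‖T‖ ≤ √‖star T * T‖ * √‖star T * T‖ := by gcongr
      _ = _ := Real.mul_self_sqrt (norm_nonneg _)

lemma isClosed_adjointable : IsClosed (P.adjointable ι : Set (P.Fock ι →L[ℂ] P.Fock ι)) := by
  refine isClosed_of_closure_subset fun T hT => ?_
  obtain ⟨t, ht, hlim⟩ := mem_closure_iff_seq_limit.1 hT
  choose s hs using ht
  have hc : CauchySeq s := by
    have hct := hlim.cauchySeq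
    rw [Metric.cauchySeq_iff'] at hct ⊢
    intro ε hε
    obtain ⟨N, hN⟩ := hct ε hε
    refine ⟨N, fun n hn => lt_of_le_of_lt ?_ (hN n hn)⟩
    rw [dist_eq_norm, dist_eq_norm]
    refine IsAdj.norm_le fun x y => ?_
    have h1 := (hs N).smul (-1)
    have h2 := (hs n).add h1
    have h3 := h2 x y
    simpa [sub_eq_add_neg] using h3
  obtain ⟨S, hS⟩ := cauchySeq_tendsto_of_complete hc
  refine ⟨S, fun x y => ?_⟩
  have e1 : Filter.Tendsto (fun n => P.ip (t n x) y) Filter.atTop (nhds (P.ip (T x) y)) := by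
    have h1 : Filter.Tendsto (fun n => t n x) Filter.atTop (nhds (T x)) :=
      ((ContinuousLinearMap.apply ℂ (P.Fock ι) x).continuous.tendsto T).comp hlim
    exact ((P.continuous_ip.comp (continuous_id.prodMk continuous_const)).tendsto (T x)).comp h1
  have e2 : Filter.Tendsto (fun n => P.ip x (s n y)) Filter.atTop (nhds (P.ip x (S y))) := by
    have h1 : Filter.Tendsto (fun n => s n y) Filter.atTop (nhds (S y)) :=
      ((ContinuousLinearMap.apply ℂ (P.Fock ι) y).continuous.tendsto S).comp hS
    exact ((P.continuous_ip.comp (continuous_const.prodMk continuous_id)).tendsto (S y)).comp h1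
  refine tendsto_nhds_unique e1 ?_
  simpa only [fun n => hs n x y] using e2

instance : CompleteSpace (P.adjointable ι) := isClosed_adjointable.completeSpace_coe

instance : CStarAlgebra (P.adjointable ι) where

variable (P)

/-- The bounded operator `λ^i_a`. -/
def lamCLM (i : ι) (a : D) : P.Fock ι →L[ℂ] P.Fock ι :=
  P.extend ((P.pre i a).mkContinuous ‖a‖ (P.norm_pre_le i a))

@[simp] lemma lamCLM_toFock (i : ι) (a : D) (x : P.PreFock ι) :
    P.lamCLM i a (P.toFock x) = P.toFock (P.pre i a x) :=
  P.extend_toFock _ x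

variable {P} in
lemma clm_ext {T S : P.Fock ι →L[ℂ] P.Fock ι}
    (h : ∀ x y : P.PreFock ι, P.ip (P.toFock x) (T (P.toFock y))
      = P.ip (P.toFock x) (S (P.toFock y))) : T = S :=
  ContinuousLinearMap.ext fun y => P.eq_of_ip fun x =>
    P.fock_induction₂ (p := fun x y => P.ip x (T y) = P.ip x (S y)) x y
      (isClosed_eq (by fun_prop) (by fun_prop)) h

lemma isAdj_lamCLM (i : ι) (a : D) : P.IsAdj (P.lamCLM i a) (P.lamCLM i (star a)) := fun x y =>
  P.fock_induction₂ (p := fun x y => P.ip (P.lamCLM i a x) y = P.ip x (P.lamCLM i (star a) y)) x y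
      (isClosed_eq (by fun_prop) (by fun_prop)) fun x y => by
    simp only [lamCLM_toFock, ip_toFock, form_pre_left]

lemma ip_lamCLM (i : ι) (a : D) (x y : P.PreFock ι) :
    P.ip (P.toFock x) (P.lamCLM i a (P.toFock y)) = P.form x (P.pre i a y) := by
  rw [lamCLM_toFock, ip_toFock]

lemma lamCLM_one (i : ι) : P.lamCLM i 1 = 1 := clm_ext fun x y => by
  rw [ip_lamCLM, form_pre_one, one_apply_eq_self, ip_toFock]

lemma lamCLM_mul (i : ι) (a c : D) : P.lamCLM i (a * c) = P.lamCLM i a * P.lamCLM i c :=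
  clm_ext fun x y => by
    rw [ip_lamCLM, mul_apply_eq_comp, lamCLM_toFock, ip_lamCLM, form_pre_mul]

lemma lamCLM_add (i : ι) (a c : D) : P.lamCLM i (a + c) = P.lamCLM i a + P.lamCLM i c :=
  clm_ext fun x y => by
    rw [ip_lamCLM, add_apply, ip_add, ip_lamCLM, ip_lamCLM, form_pre_add]

lemma lamCLM_smul (i : ι) (z : ℂ) (a : D) : P.lamCLM i (z • a) = z • P.lamCLM i a :=
  clm_ext fun x y => by
    rw [ip_lamCLM, smul_apply, ip_smul, ip_lamCLM, form_pre_smul]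

/-- The operator `λ^i_a` as an adjointable operator. -/
def lamOp (i : ι) (a : D) : P.adjointable ι := ⟨P.lamCLM i a, P.lamCLM i (star a), P.isAdj_lamCLM i a⟩

lemma star_lamOp (i : ι) (a : D) : star (P.lamOp i a) = P.lamOp i (star a) :=
  star_eq_of_isAdj (T := P.lamOp i a) (S := P.lamOp i (star a)) (P.isAdj_lamCLM i a)

lemma lamOp_smul (i : ι) (z : ℂ) (a : D) : P.lamOp i (z • a) = z • P.lamOp i a :=
  Subtype.ext (P.lamCLM_smul i z a)

lemma lamOp_one (i : ι) : P.lamOp i 1 = 1 := Subtype.ext (P.lamCLM_one i)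

/-- The unital *-homomorphism `a ↦ λ^i_a`. -/
def lam (i : ι) : D →⋆ₐ[ℂ] P.adjointable ι where
  toFun := P.lamOp i
  map_one' := P.lamOp_one i
  map_mul' a c := Subtype.ext (P.lamCLM_mul i a c)
  map_zero' := by
    have := P.lamOp_smul i 0 0
    rwa [zero_smul, zero_smul] at this
  map_add' a c := Subtype.ext (P.lamCLM_add i a c)
  commutes' z := by
    rw [Algebra.algebraMap_eq_smul_one, Algebra.algebraMap_eq_smul_one, lamOp_smul, lamOp_one]
  map_star' a := (P.star_lamOp i a).symm

lemma lam_incl (i j : ι) (b : B) : P.lam i (P.incl b) = P.lam j (P.incl b) :=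
  Subtype.ext <| clm_ext fun x y => by
    change P.ip _ (P.lamCLM i _ (P.toFock y)) = P.ip _ (P.lamCLM j _ (P.toFock y))
    rw [ip_lamCLM, ip_lamCLM, P.form_pre_incl i j]

variable (ι) in
/-- The empty word. -/
def nilWord : P.Word ι := ⟨[], List.isChain_nil⟩

variable (ι) in
/-- The vacuum vector: the unit of `B`, at the empty word. -/
def vac : P.Fock ι := P.toFock (P.gen (P.nilWord ι) 1)

variable (ι) in
/-- The C*-algebra of adjointable operators that is generated by all the `λ^i_a`. -/
def freeProductSubalgebra : StarSubalgebra ℂ (P.adjointable ι) :=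
  (StarAlgebra.adjoin ℂ (⋃ i, Set.range (P.lam i))).topologicalClosure

instance : IsClosed (P.freeProductSubalgebra ι : Set (P.adjointable ι)) :=
  StarSubalgebra.isClosed_topologicalClosure _

variable (ι) in
/-- The reduced amalgamated free product of copies, indexed by `ι`, of `(D, exp)` over `B`, as a type. -/
def FreeProduct : Type _ := P.freeProductSubalgebra ι

instance : CStarAlgebra (P.FreeProduct ι) :=
  inferInstanceAs (CStarAlgebra (P.freeProductSubalgebra ι))

lemma lam_mem (i : ι) (a : D) : P.lam i a ∈ P.freeProductSubalgebra ι :=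
  StarSubalgebra.le_topologicalClosure _
    (StarAlgebra.subset_adjoin ℂ _ (Set.mem_iUnion.2 ⟨i, a, rfl⟩))

/-- The free product acts on the Hilbert module. -/
def inclOp : P.FreeProduct ι →⋆ₐ[ℂ] P.adjointable ι := (P.freeProductSubalgebra ι).subtype

/-- The *-homomorphism `a ↦ λ^i_a` into the free product. -/
def emb (i : ι) : D →⋆ₐ[ℂ] P.FreeProduct ι :=
  StarAlgHom.codRestrict (P.lam i) (P.freeProductSubalgebra ι) (P.lam_mem i)

/-- The map `x ↦ ⟨1, x 1⟩` with values in `B`, where `1` is the vacuum vector. -/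
def vacExp : P.FreeProduct ι →ₗ[ℂ] B where
  toFun x := P.ip (P.vac ι) ((P.inclOp x).1 (P.vac ι))
  map_add' x y := by rw [map_add]; exact P.ip_add _ _ _
  map_smul' z x := by rw [map_smul]; exact P.ip_smul _ _ _

/-- The canonical copy of `B` in the free product; it does not depend on the index used. -/
def baseEmb [Inhabited ι] : B →⋆ₐ[ℂ] P.FreeProduct ι := (P.emb default).comp P.incl

lemma baseEmb_apply [Inhabited ι] (i : ι) (b : B) : P.baseEmb b = P.emb i (P.incl b) :=
  Subtype.ext (P.lam_incl _ i _)

lemma vacExp_emb (i : ι) (a : D) : P.vacExp (P.emb i a) = P.exp a := by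
  change P.ip (P.vac ι) (P.lamCLM i a (P.vac ι)) = _
  rw [vac, ip_lamCLM, form_gen_pre]
  simp [nilWord, rest, coeff, P.exp_incl]

/-- The conditional expectation `E` of the free product onto the copy of `B` in it. -/
def baseExp [Inhabited ι] : P.FreeProduct ι →ₗ[ℂ] P.FreeProduct ι :=
  P.baseEmb.toAlgHom.toLinearMap ∘ₗ P.vacExp

/-- The free shift: the automorphism that carries `λ^i_a` to `λ^{i+1}_a`. -/
def IsFreeShift (α : P.FreeProduct ℤ ≃⋆ₐ[ℂ] P.FreeProduct ℤ) : Prop :=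
  ∀ (i : ℤ) (a : D), α (P.emb i a) = P.emb (i + 1) a

end CondExp
end Tomiyama

/-- A conditional expectation of `A` onto the subalgebra `S`: a projection onto `S` that is
contractive (that is, of norm one unless `A = 0`). -/
structure IsConditionalExpectation {A : Type*} [CStarAlgebra A] (S : StarSubalgebra ℂ A)
    (E : A →ₗ[ℂ] A) : Prop where
  mem : ∀ x, E x ∈ S
  map_of_mem : ∀ x ∈ S, E x = x
  norm_le : ∀ x, ‖E x‖ ≤ ‖x‖

/-- The data `(D, E₀)` with `E₀` a conditional expectation of `D` onto the C*-subalgebra `B`. -/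
def CondExp.ofSubalgebra {D : Type*} [CStarAlgebra D] (B : StarSubalgebra ℂ D)
    [IsClosed (B : Set D)] (E₀ : D →ₗ[ℂ] D) (hE₀ : IsConditionalExpectation B E₀) :
    CondExp D B where
  incl := B.subtype
  exp := E₀.codRestrict (Subalgebra.toSubmodule B.toSubalgebra) hE₀.mem
  exp_incl b := Subtype.ext (hE₀.map_of_mem b b.2)
  norm_exp_le := hE₀.norm_le

/-- The fixed-point subalgebra of an automorphism. -/
def fixedPoints {A : Type*} [CStarAlgebra A] (α : A ≃⋆ₐ[ℂ] A) : StarSubalgebra ℂ A where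
  carrier := {x | α x = x}
  mul_mem' {x y} hx hy := by
    change α (x * y) = x * y
    rw [map_mul, hx, hy]
  add_mem' {x y} hx hy := by
    change α (x + y) = x + y
    rw [map_add, hx, hy]
  algebraMap_mem' z := by
    change α (algebraMap ℂ A z) = algebraMap ℂ A z
    rw [Algebra.algebraMap_eq_smul_one, map_smul, map_one]
  star_mem' {x} hx := by
    change α (star x) = star x
    rw [map_star, hx]

/-- A state: a positive linear functional with value `1` at the unit. -/
structure IsState {A : Type*} [CStarAlgebra A] (φ : A →ₗ[ℂ] ℂ) : Prop where
  re_nonneg : ∀ x, 0 ≤ (φ (star x * x)).re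
  im_eq_zero : ∀ x, (φ (star x * x)).im = 0
  map_one : φ 1 = 1

/-- The automorphism `α` is `E`-mixing: `φ (αⁿ x) → φ (E x)` for every state `φ` and every `x`. -/
def IsEMixing {A : Type*} [CStarAlgebra A] (α : A ≃⋆ₐ[ℂ] A) (E : A →ₗ[ℂ] A) : Prop :=
  ∀ φ : A →ₗ[ℂ] ℂ, IsState φ → ∀ x : A,
    Filter.Tendsto (fun n : ℕ => φ (α^[n] x)) Filter.atTop (nhds (φ (E x)))

end

noncomputable section

/-! Every permutation of the indices acts on words and leaves the inner product unchanged, because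
the inner product only asks whether two indices are equal. It therefore gives a unitary of the
Hilbert module which carries `λ^i_a` to `λ^{σ i}_a` by conjugation. The free shift is the case `σ i
= i + 1`. It is unique because the `λ^i_a` generate the algebra and *-homomorphisms are continuous.

Everything else rests on one norm estimate. Let `p i` be the projection onto the words that begin
with `i`. If `a` is centred, then `λ^i_a` puts `a` in front of every word that does not begin with
`i`, so `(1 - p i) λ^i_a (1 - p i) = 0` (`compression_lam`). By induction, a product `x` of a
nonempty reduced word with first index `i` and last index `j` satisfies `x = p i x + (1 - p i) x p
j` (`compression_wordProd`). For the shifts of `x` the projections `p (i + k)` are pairwise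
orthogonal, and so are the `p (j + k)`. In a combination of the shifts, the first summands thus have
orthogonal ranges, and so do the adjoints of the second ones. Pythagoras gives `‖∑ c k • α^k x‖ ≤ 2
‖x‖ (∑ |c k|²)^{1/2}` (`norm_sum_iterate_le`).

With weights `1 / n` the averages of `α^k x` tend to `0` in norm. The copy of `B` is fixed, and `B`
together with the reduced words spans a dense subspace, so the averages of any `x` converge to `E
x`. A fixed `x` equals its averages, hence `E x = x`. With `c k` the conjugate of `φ (α^k x)`, the
same estimate shows that these numbers are square summable, so they tend to `0`; this is mixing on
reduced words, and density gives the rest. -/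

/-- Conjugation by `u` preserves the C*-algebra generated by `s` if it maps `s` into it. -/
lemma conjStarAlgAut_mem_of_generators {A : Type*} [CStarAlgebra A] {u : unitary A} {s : Set A}
    (hs : ∀ x ∈ s, Unitary.conjStarAlgAut ℂ A u x ∈ (StarAlgebra.adjoin ℂ s).topologicalClosure)
    {x : A} (hx : x ∈ (StarAlgebra.adjoin ℂ s).topologicalClosure) :
    Unitary.conjStarAlgAut ℂ A u x ∈ (StarAlgebra.adjoin ℂ s).topologicalClosure := by
  have hc : Continuous (Unitary.conjStarAlgAut ℂ A u) := by
    change Continuous fun x => (u : A) * x * (star u : A)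
    fun_prop
  have h : (StarAlgebra.adjoin ℂ s).topologicalClosure ≤
      (StarAlgebra.adjoin ℂ s).topologicalClosure.comap
        (Unitary.conjStarAlgAut ℂ A u).toStarAlgHom :=
    StarSubalgebra.topologicalClosure_minimal (StarAlgebra.adjoin_le hs)
      ((StarSubalgebra.isClosed_topologicalClosure _).preimage hc)
  exact h hx

namespace CondExp

variable {D B : Type*} [CStarAlgebra D] [CStarAlgebra B] (P : CondExp D B)
variable {ι : Type*} [DecidableEq ι]

/-! ### Relabelling the indices -/

/-- The list of letters whose indices are changed by `σ`. -/
def relabelList (σ : Equiv.Perm ι) (l : List (P.Letter ι)) : List (P.Letter ι) :=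
  l.map fun p => (σ p.1, p.2)

/-- Indices enter `kernel` only through the tests `i = j`, whose outcome an injective map preserves.
-/
lemma kernel_relabelList (σ : Equiv.Perm ι) (s t : List (P.Letter ι)) (x : D) :
    P.kernel (P.relabelList σ s) (P.relabelList σ t) x = P.kernel s t x := by
  induction s generalizing t x with
  | nil => cases t <;> simp [relabelList]
  | cons p s ih => cases t with
    | nil => simp [relabelList]
    | cons q t =>
      obtain ⟨i, a⟩ := p
      obtain ⟨j, c⟩ := q
      change P.kernel ((σ i, a) :: P.relabelList σ s) ((σ j, c) :: P.relabelList σ t) x = _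
      simp only [kernel_cons_cons, ih, σ.injective.eq_iff]

lemma isChain_relabelList (σ : Equiv.Perm ι) {l : List (P.Letter ι)}
    (hl : l.IsChain fun p q => p.1 ≠ q.1) :
    (P.relabelList σ l).IsChain fun p q => p.1 ≠ q.1 := by
  rw [relabelList, List.isChain_map]
  exact hl.imp fun p q h => by simpa using h

/-- This group law makes the operator of `σ⁻¹` inverse to that of `σ`, which is why all permutations
are treated and not the shift alone. -/
lemma relabelList_relabelList (σ τ : Equiv.Perm ι) (l : List (P.Letter ι)) :
    P.relabelList σ (P.relabelList τ l) = P.relabelList (σ * τ) l := by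
  simp [relabelList]

lemma relabelList_one (l : List (P.Letter ι)) : P.relabelList 1 l = l := by
  simp [relabelList]

/-- The splitting `w = coeff i w ⊗ rest i w` is equivariant. As `pre i a` is governed by this
splitting, it is what turns index `i` into index `σ i` in the left action. -/
lemma rest_relabelList (σ : Equiv.Perm ι) (i : ι) (l : List (P.Letter ι)) :
    P.rest (σ i) (P.relabelList σ l) = P.relabelList σ (P.rest i l) := by
  rcases l with _ | ⟨⟨j, c⟩, t⟩
  · simp [rest, relabelList]
  · by_cases h : j = i <;> simp [rest, relabelList, h]

lemma coeff_relabelList (σ : Equiv.Perm ι) (i : ι) (l : List (P.Letter ι)) :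
    P.coeff (σ i) (P.relabelList σ l) = P.coeff i l := by
  rcases l with _ | ⟨⟨j, c⟩, t⟩
  · simp [coeff, relabelList]
  · by_cases h : j = i <;> simp [coeff, relabelList, h]

/-- The word whose indices are changed by `σ`. -/
def relabelWord (σ : Equiv.Perm ι) (w : P.Word ι) : P.Word ι :=
  ⟨P.relabelList σ w.1, P.isChain_relabelList σ w.2⟩

/-- The change of indices on the module of words. -/
def relabelPre (σ : Equiv.Perm ι) : P.PreFock ι →ₗ[ℂ] P.PreFock ι :=
  Finsupp.lsum ℂ fun w : P.Word ι => P.gen (P.relabelWord σ w)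

@[simp] lemma relabelPre_gen (σ : Equiv.Perm ι) (w : P.Word ι) (b : B) :
    P.relabelPre σ (P.gen w b) = P.gen (P.relabelWord σ w) b :=
  Finsupp.lsum_single _ _ _ _

lemma relabelPre_relabelPre (σ τ : Equiv.Perm ι) (x : P.PreFock ι) :
    P.relabelPre σ (P.relabelPre τ x) = P.relabelPre (σ * τ) x := by
  induction x using preFock_induction with
  | h0 => simp
  | ha x x' hx hx' => simp [hx, hx']
  | hg w b =>
    rw [relabelPre_gen, relabelPre_gen, relabelPre_gen]
    congr 2
    exact Subtype.ext (P.relabelList_relabelList σ τ w.1)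

lemma relabelPre_one (x : P.PreFock ι) : P.relabelPre 1 x = x := by
  induction x using preFock_induction with
  | h0 => simp
  | ha x x' hx hx' => simp [hx, hx']
  | hg w b =>
    rw [relabelPre_gen]
    congr 2
    exact Subtype.ext (P.relabelList_one w.1)

lemma form_relabelPre (σ : Equiv.Perm ι) (x y : P.PreFock ι) :
    P.form (P.relabelPre σ x) (P.relabelPre σ y) = P.form x y := by
  induction x using preFock_induction with
  | h0 => simp
  | ha x x' hx hx' => simp [hx, hx']
  | hg w b =>
    induction y using preFock_induction with
    | h0 => simp
    | ha x x' hx hx' => simp only [map_add, hx, hx']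
    | hg w' b' =>
      rw [relabelPre_gen, relabelPre_gen, form_gen, form_gen]
      simp only [relabelWord, kernel_relabelList]

/-- The intertwining relation is tested against vectors: `form_gen_pre` expresses these inner
products through `rest`, `coeff` and `kernel`, all equivariant, so the two terms of `pre_gen` need
not be followed separately. -/
lemma form_pre_relabelPre (σ : Equiv.Perm ι) (i : ι) (a : D) (x y : P.PreFock ι) :
    P.form (P.relabelPre σ x) (P.pre (σ i) a (P.relabelPre σ y)) = P.form x (P.pre i a y) := by
  induction x using preFock_induction with
  | h0 => simp
  | ha x x' hx hx' => simp [hx, hx']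
  | hg w b =>
    induction y using preFock_induction with
    | h0 => simp
    | ha x x' hx hx' => simp only [map_add, hx, hx']
    | hg w' b' =>
      rw [relabelPre_gen, relabelPre_gen, form_gen_pre, form_gen_pre]
      simp [relabelWord, rest_relabelList, coeff_relabelList, kernel_relabelList]

/-- The change of indices on the Hilbert module. -/
def relabelCLM (σ : Equiv.Perm ι) : P.Fock ι →L[ℂ] P.Fock ι :=
  P.extend ((P.relabelPre σ).mkContinuous 1 fun x => by
    rw [one_mul, norm_def, norm_def, form_relabelPre])

@[simp] lemma relabelCLM_toFock (σ : Equiv.Perm ι) (x : P.PreFock ι) :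
    P.relabelCLM σ (P.toFock x) = P.toFock (P.relabelPre σ x) :=
  P.extend_toFock _ x

lemma relabelCLM_mul (σ τ : Equiv.Perm ι) :
    P.relabelCLM (σ * τ) = P.relabelCLM σ * P.relabelCLM τ := clm_ext fun x y => by
  simp only [mul_apply_eq_comp, relabelCLM_toFock, relabelPre_relabelPre]

lemma relabelCLM_one : P.relabelCLM (1 : Equiv.Perm ι) = 1 := clm_ext fun x y => by
  rw [relabelCLM_toFock, relabelPre_one, one_apply_eq_self]

/-- An invertible map that preserves the inner product has its inverse as adjoint. -/
lemma isAdj_relabelCLM (σ : Equiv.Perm ι) : P.IsAdj (P.relabelCLM σ) (P.relabelCLM σ⁻¹) :=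
  fun x y => P.fock_induction₂
    (p := fun x y => P.ip (P.relabelCLM σ x) y = P.ip x (P.relabelCLM σ⁻¹ y)) x y
    (isClosed_eq (by fun_prop) (by fun_prop)) fun x y => by
      rw [relabelCLM_toFock, relabelCLM_toFock, ip_toFock, ip_toFock,
        ← form_relabelPre P σ x, relabelPre_relabelPre, mul_inv_cancel, relabelPre_one]

/-- The change of indices as a unitary operator. -/
def relabelUnitary (σ : Equiv.Perm ι) : unitary (P.adjointable ι) :=
  ⟨⟨P.relabelCLM σ, P.relabelCLM σ⁻¹, P.isAdj_relabelCLM σ⟩, by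
    have h : star (⟨P.relabelCLM σ, P.relabelCLM σ⁻¹, P.isAdj_relabelCLM σ⟩ : P.adjointable ι)
        = ⟨P.relabelCLM σ⁻¹, P.relabelCLM σ, (P.isAdj_relabelCLM σ).symm⟩ :=
      star_eq_of_isAdj (P.isAdj_relabelCLM σ)
    rw [Unitary.mem_iff, h]
    constructor <;> refine Subtype.ext ?_
    · change P.relabelCLM σ⁻¹ * P.relabelCLM σ = 1
      rw [← relabelCLM_mul, inv_mul_cancel, relabelCLM_one]
    · change P.relabelCLM σ * P.relabelCLM σ⁻¹ = 1
      rw [← relabelCLM_mul, mul_inv_cancel, relabelCLM_one]⟩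

lemma relabelUnitary_mul_lam (σ : Equiv.Perm ι) (i : ι) (a : D) :
    (P.relabelUnitary σ : P.adjointable ι) * P.lam i a
      = P.lam (σ i) a * (P.relabelUnitary σ : P.adjointable ι) :=
  Subtype.ext <| clm_ext fun x y => by
    change P.ip _ (P.relabelCLM σ (P.lamCLM i a (P.toFock y)))
      = P.ip _ (P.lamCLM (σ i) a (P.relabelCLM σ (P.toFock y)))
    -- The test vector is taken in the form `σ z`, so that the invariance of the form removes `σ`
    -- from both sides.
    obtain ⟨z, rfl⟩ : ∃ z, x = P.relabelPre σ z :=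
      ⟨P.relabelPre σ⁻¹ x, by rw [relabelPre_relabelPre, mul_inv_cancel, relabelPre_one]⟩
    rw [lamCLM_toFock, relabelCLM_toFock, relabelCLM_toFock, ip_lamCLM, ip_toFock,
      form_relabelPre, form_pre_relabelPre]

lemma conj_lam (σ : Equiv.Perm ι) (i : ι) (a : D) :
    Unitary.conjStarAlgAut ℂ _ (P.relabelUnitary σ) (P.lam i a) = P.lam (σ i) a := by
  rw [Unitary.conjStarAlgAut_apply, relabelUnitary_mul_lam, mul_assoc]
  simp

lemma conj_mem (σ : Equiv.Perm ι) {x : P.adjointable ι} (hx : x ∈ P.freeProductSubalgebra ι) :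
    Unitary.conjStarAlgAut ℂ _ (P.relabelUnitary σ) x ∈ P.freeProductSubalgebra ι :=
  conjStarAlgAut_mem_of_generators (by
    rintro _ h
    obtain ⟨i, a, rfl⟩ := Set.mem_iUnion.1 h
    rw [conj_lam]
    exact P.lam_mem _ _) hx

/-- The change of indices on the free product. -/
def relabelHom (σ : Equiv.Perm ι) : P.FreeProduct ι →⋆ₐ[ℂ] P.FreeProduct ι :=
  StarAlgHom.codRestrict ((Unitary.conjStarAlgAut ℂ _ (P.relabelUnitary σ)).toStarAlgHom.comp
    P.inclOp) (P.freeProductSubalgebra ι) fun x => P.conj_mem σ x.2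

lemma relabelHom_emb (σ : Equiv.Perm ι) (i : ι) (a : D) :
    P.relabelHom σ (P.emb i a) = P.emb (σ i) a :=
  Subtype.ext (P.conj_lam σ i a)
/-! ### The span of the reduced words -/

/-- The product `λ^{i₁}_{a₁} ⋯ λ^{iₙ}_{aₙ}` in the free product. -/
def wordProd (l : List (P.Letter ι)) : P.FreeProduct ι :=
  (l.map fun p => P.emb p.1 (p.2 : D)).prod

@[simp] lemma wordProd_nil : P.wordProd ([] : List (P.Letter ι)) = 1 := rfl

@[simp] lemma wordProd_cons (i : ι) (a : {a : D // P.exp a = 0}) (l : List (P.Letter ι)) :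
    P.wordProd ((i, a) :: l) = P.emb i (a : D) * P.wordProd l := by
  simp [wordProd]

variable (ι) in
/-- The linear span of the copy of `B` and of the products of nonempty reduced words. -/
def reducedSpan [Inhabited ι] : Submodule ℂ (P.FreeProduct ι) :=
  Submodule.span ℂ (Set.range P.baseEmb ∪
    {x | ∃ l : List (P.Letter ι), l ≠ [] ∧ (l.IsChain fun p q => p.1 ≠ q.1) ∧ P.wordProd l = x})

section
variable [Inhabited ι]

lemma baseEmb_mem (b : B) : P.baseEmb b ∈ P.reducedSpan ι :=
  Submodule.subset_span (Or.inl ⟨b, rfl⟩)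

lemma wordProd_mem {l : List (P.Letter ι)} (hl : l.IsChain fun p q => p.1 ≠ q.1) :
    P.wordProd l ∈ P.reducedSpan ι := by
  by_cases h : l = []
  · subst h
    simpa using P.baseEmb_mem (ι := ι) 1
  · exact Submodule.subset_span (Or.inr ⟨l, h, hl, rfl⟩)

lemma emb_eq_ctr_add (i : ι) (a : D) :
    P.emb i a = P.emb i (P.ctr a : D) + P.baseEmb (P.exp a) := by
  rw [P.baseEmb_apply i, ← map_add, ctr, sub_add_cancel]

/-- The factor from `B` is absorbed by the first letter, which stays centred since `exp` is a left
`B`-module map. For the empty word it remains as an element of `B`, which is why `reducedSpan`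
contains all of `B`. -/
lemma baseEmb_mul_wordProd_mem (b : B) {l : List (P.Letter ι)}
    (hl : l.IsChain fun p q => p.1 ≠ q.1) : P.baseEmb b * P.wordProd l ∈ P.reducedSpan ι := by
  rcases l with _ | ⟨⟨j, c⟩, t⟩
  · simpa using P.baseEmb_mem b
  · have : P.baseEmb b * P.wordProd ((j, c) :: t) = P.wordProd (P.lmul b ((j, c) :: t)) := by
      rw [lmul, wordProd_cons, wordProd_cons, P.baseEmb_apply j, ← mul_assoc, ← map_mul]
    rw [this]
    exact P.wordProd_mem (P.isChain_lmul b hl)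

/-- The computation copies the left action on the module. The word factors as `coeff i l` times
`rest i l`, the coefficient merges with `a`, and the merged letter splits into its centred part,
which may precede `rest i l`, and its expectation, which lies in `B`. -/
lemma emb_mul_wordProd_mem (i : ι) (a : D) {l : List (P.Letter ι)}
    (hl : l.IsChain fun p q => p.1 ≠ q.1) : P.emb i a * P.wordProd l ∈ P.reducedSpan ι := by
  have h : P.wordProd l = P.emb i (P.coeff i l) * P.wordProd (P.rest i l) := by
    rcases l with _ | ⟨⟨j, c⟩, t⟩
    · simp [coeff, rest]
    · by_cases h : j = i
      · subst h; simp [coeff, rest]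
      · simp [coeff, rest, h]
  rw [h, ← mul_assoc, ← map_mul, emb_eq_ctr_add, add_mul, ← wordProd_cons]
  exact add_mem (P.wordProd_mem (P.isChain_push i _ hl))
    (P.baseEmb_mul_wordProd_mem _ (P.isChain_rest i hl))

lemma emb_mul_mem (i : ι) (a : D) {x : P.FreeProduct ι} (hx : x ∈ P.reducedSpan ι) :
    P.emb i a * x ∈ P.reducedSpan ι := by
  induction hx using Submodule.span_induction with
  | mem x h =>
    obtain ⟨b, rfl⟩ | ⟨l, -, hl, rfl⟩ := h
    · rw [P.baseEmb_apply i, ← map_mul, emb_eq_ctr_add]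
      refine add_mem ?_ (P.baseEmb_mem _)
      simpa using P.wordProd_mem (l := [(i, P.ctr (a * P.incl b))]) (by simp)
    · exact P.emb_mul_wordProd_mem i a hl
  | zero => simp
  | add x y _ _ hx hy => rw [mul_add]; exact add_mem hx hy
  | smul z x _ hx => rw [mul_smul_comm]; exact Submodule.smul_mem _ z hx

/-- A subspace that contains `1` and is stable under left multiplication by the generators contains
the algebra they generate. No product of two long words has to be reduced. -/
lemma adjoin_emb_le_reducedSpan :
    Subalgebra.toSubmodule (StarAlgebra.adjoin ℂ
      (⋃ i, Set.range (P.emb i : D → P.FreeProduct ι))).toSubalgebra ≤ P.reducedSpan ι := by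
  let s : Set (P.FreeProduct ι) := ⋃ i, Set.range (P.emb i)
  -- The generators are closed under the adjoint, so the *-algebra they generate is the plain
  -- algebra they generate.
  have hs : s ∪ star s = s := by
    refine Set.union_eq_self_of_subset_right fun x hx => ?_
    obtain ⟨i, a, ha⟩ := Set.mem_iUnion.1 hx
    exact Set.mem_iUnion.2 ⟨i, star a, by rw [map_star, ha, star_star]⟩
  intro x hx
  change x ∈ Algebra.adjoin ℂ (s ∪ star s) at hx
  rw [hs] at hx
  -- The induction needs the stronger claim that left multiplication by `x` preserves the span; the
  -- original one is the case `y = 1`.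
  suffices h : ∀ y ∈ P.reducedSpan ι, x * y ∈ P.reducedSpan ι by
    have h1 := h 1 (by simpa using P.baseEmb_mem (ι := ι) 1)
    rwa [mul_one] at h1
  induction hx using Algebra.adjoin_induction with
  | mem x hx =>
    obtain ⟨i, a, rfl⟩ := Set.mem_iUnion.1 hx
    exact fun y hy => P.emb_mul_mem i a hy
  | algebraMap z =>
    intro y hy
    rw [Algebra.algebraMap_eq_smul_one, smul_mul_assoc, one_mul]
    exact Submodule.smul_mem _ z hy
  | add x x' _ _ hx hx' =>
    intro y hy
    rw [add_mul]; exact add_mem (hx y hy) (hx' y hy)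
  | mul x x' _ _ hx hx' =>
    intro y hy
    rw [mul_assoc]; exact hx _ (hx' y hy)

/-- The free product is a closure taken inside `adjointable`; since its topology is induced from
there, that closure becomes density in the free product itself. -/
lemma dense_reducedSpan : Dense (P.reducedSpan ι : Set (P.FreeProduct ι)) := by
  have h : StarAlgebra.adjoin ℂ (⋃ i, Set.range (P.lam i : D → P.adjointable ι)) ≤
      (StarAlgebra.adjoin ℂ (⋃ i, Set.range (P.emb i : D → P.FreeProduct ι))).map P.inclOp := by
    refine StarAlgebra.adjoin_le ?_
    rintro _ h
    obtain ⟨i, a, rfl⟩ := Set.mem_iUnion.1 h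
    exact ⟨P.emb i a, StarAlgebra.subset_adjoin ℂ _ (Set.mem_iUnion.2 ⟨i, a, rfl⟩), rfl⟩
  intro x
  have hind : Topology.IsInducing (P.inclOp : P.FreeProduct ι → P.adjointable ι) :=
    Topology.IsInducing.subtypeVal
  rw [hind.closure_eq_preimage_closure_image]
  refine closure_mono (fun y hy => ?_) x.2
  obtain ⟨z, hz, rfl⟩ := h hy
  exact ⟨z, P.adjoin_emb_le_reducedSpan hz, rfl⟩

/-- A *-homomorphism on the free product is determined by its values on the `λ^i_a`. -/
lemma starAlgHom_ext {A : Type*} [CStarAlgebra A] {f g : P.FreeProduct ι →⋆ₐ[ℂ] A}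
    (h : ∀ i a, f (P.emb i a) = g (P.emb i a)) : f = g := by
  -- Continuity is automatic: a *-homomorphism between C*-algebras is contractive.
  have hcont : ∀ f : P.FreeProduct ι →⋆ₐ[ℂ] A, Continuous f := fun f =>
    AddMonoidHomClass.continuous_of_bound f 1 fun x => by
      rw [one_mul]; exact NonUnitalStarAlgHom.norm_apply_le f x
  have hfg : (f : P.FreeProduct ι → A) = g := by
    refine (hcont f).ext_on P.dense_reducedSpan (hcont g) fun x hx => ?_
    have hle : P.reducedSpan ι ≤ LinearMap.eqLocus f.toAlgHom.toLinearMap g.toAlgHom.toLinearMap := by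
      refine Submodule.span_le.2 ?_
      rintro _ (⟨b, rfl⟩ | ⟨l, -, -, rfl⟩)
      · change f _ = g _
        rw [P.baseEmb_apply default, h]
      · change f _ = g _
        simp only [wordProd, map_list_prod, List.map_map]
        congr 1
        exact List.map_congr_left fun p _ => h p.1 p.2
    exact hle hx
  exact DFunLike.coe_injective hfg

lemma relabelHom_comp_relabelHom (σ τ : Equiv.Perm ι) (h : σ * τ = 1) :
    (P.relabelHom σ).comp (P.relabelHom τ) = .id ℂ (P.FreeProduct ι) :=
  P.starAlgHom_ext fun i a => by
    rw [StarAlgHom.comp_apply, relabelHom_emb, relabelHom_emb, ← Equiv.Perm.mul_apply, h]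
    rfl

end

/-! ### Existence and uniqueness of the free shift -/

/-- The free shift, as an automorphism. -/
def freeShift : P.FreeProduct ℤ ≃⋆ₐ[ℂ] P.FreeProduct ℤ :=
  .ofStarAlgHom (P.relabelHom (Equiv.addRight 1)) (P.relabelHom (Equiv.addRight 1)⁻¹)
    (P.relabelHom_comp_relabelHom _ _ (inv_mul_cancel _))
    (P.relabelHom_comp_relabelHom _ _ (mul_inv_cancel _))

lemma isFreeShift_freeShift : P.IsFreeShift P.freeShift := fun i a =>
  P.relabelHom_emb (Equiv.addRight 1) i a

lemma IsFreeShift.unique {P : CondExp D B} {α β : P.FreeProduct ℤ ≃⋆ₐ[ℂ] P.FreeProduct ℤ}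
    (hα : P.IsFreeShift α) (hβ : P.IsFreeShift β) : α = β := by
  have h : (α : P.FreeProduct ℤ →⋆ₐ[ℂ] P.FreeProduct ℤ) = β :=
    P.starAlgHom_ext fun i a => (hα i a).trans (hβ i a).symm
  exact StarAlgEquiv.ext fun x => DFunLike.congr_fun h x

lemma existsUnique_isFreeShift :
    ∃! α : P.FreeProduct ℤ ≃⋆ₐ[ℂ] P.FreeProduct ℤ, P.IsFreeShift α :=
  ⟨P.freeShift, P.isFreeShift_freeShift, fun _ h => h.unique P.isFreeShift_freeShift⟩

end CondExp

/-! ### Norm estimates in a general C*-algebra -/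

/-- States are bounded. -/
lemma IsState.exists_norm_le {A : Type*} [CStarAlgebra A] {φ : A →ₗ[ℂ] ℂ} (hφ : IsState φ) :
    ∃ C : NNReal, ∀ x, ‖φ x‖ ≤ C * ‖x‖ := by
  -- In the spectral order the nonnegative elements are the `star y * y`, so a state becomes a
  -- positive linear map, and such maps are bounded.
  let _ := CStarAlgebra.spectralOrder A
  let _ := CStarAlgebra.spectralOrderedRing A
  open scoped ComplexOrder in
  exact (PositiveLinearMap.mk₀ φ fun x hx => by
    obtain ⟨y, rfl⟩ := CStarAlgebra.nonneg_iff_eq_star_mul_self.1 hx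
    exact Complex.nonneg_iff.2 ⟨hφ.re_nonneg y, (hφ.im_eq_zero y).symm⟩).exists_norm_apply_le

/-- The norm of a combination of elements with orthogonal ranges. -/
lemma norm_sum_smul_le_of_orthogonal {A κ : Type*} [CStarAlgebra A] (F : Finset κ) (c : κ → ℂ)
    (z : κ → A) {C : ℝ} (hC : ∀ k, ‖z k‖ ≤ C) (hz : ∀ k l, k ≠ l → star (z k) * z l = 0) :
    ‖∑ k ∈ F, c k • z k‖ ≤ C * √(∑ k ∈ F, ‖c k‖ ^ 2) := by
  classical
  -- A member of `F` is what gives `0 ≤ C`; for empty `F` both sides vanish.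
  by_cases hF : F = ∅
  · simp [hF]
  obtain ⟨k₀, -⟩ := Finset.nonempty_iff_ne_empty.2 hF
  have hC0 : 0 ≤ C := (norm_nonneg _).trans (hC k₀)
  refine abs_le_of_sq_le_sq' ?_ (by positivity) |>.2
  rw [mul_pow, Real.sq_sqrt (Finset.sum_nonneg fun _ _ => by positivity), sq,
    ← CStarRing.norm_star_mul_self]
  -- Pythagoras: orthogonality removes the mixed terms from the C*-identity.
  have h : star (∑ k ∈ F, c k • z k) * ∑ k ∈ F, c k • z k
      = ∑ k ∈ F, (star (c k) * c k) • (star (z k) * z k) := by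
    rw [star_sum, Finset.sum_mul]
    refine Finset.sum_congr rfl fun k hk => ?_
    rw [Finset.mul_sum, Finset.sum_eq_single_of_mem k hk]
    · rw [star_smul, smul_mul_smul_comm]
    · intro l _ hl
      rw [star_smul, smul_mul_smul_comm, hz k l hl.symm, smul_zero]
  rw [h, Finset.mul_sum]
  refine (norm_sum_le _ _).trans (Finset.sum_le_sum fun k _ => ?_)
  rw [norm_smul, CStarRing.norm_star_mul_self, CStarRing.norm_star_mul_self, mul_comm, ← sq, ← sq]
  gcongr
  exact hC k

/-- Elements that are compressed by two families of orthogonal projections have combinations of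
small norm. -/
lemma norm_sum_smul_le_of_compression {A κ : Type*} [CStarAlgebra A] (F : Finset κ) (c : κ → ℂ)
    (x q r : κ → A) {C : ℝ} (hC : ∀ k, ‖x k‖ ≤ C)
    (hq : ∀ k, IsStarProjection (q k)) (hr : ∀ k, IsStarProjection (r k))
    (hqo : ∀ k l, k ≠ l → q k * q l = 0) (hro : ∀ k l, k ≠ l → r k * r l = 0)
    (hx : ∀ k, (1 - q k) * x k = (1 - q k) * x k * r k) :
    ‖∑ k ∈ F, c k • x k‖ ≤ 2 * C * √(∑ k ∈ F, ‖c k‖ ^ 2) := by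
  -- Each `x k` is `q k * x k + (1 - q k) * x k * r k`. The ranges of the second terms need not be
  -- orthogonal, but those of their adjoints are, because the adjoints begin with `r k`. Each sum
  -- contributes one of the two factors in `2 * C`.
  have e : ∑ k ∈ F, c k • x k = ∑ k ∈ F, c k • (q k * x k) +
      star (∑ k ∈ F, star (c k) • (r k * star ((1 - q k) * x k))) := by
    rw [star_sum, ← Finset.sum_add_distrib]
    refine Finset.sum_congr rfl fun k _ => ?_
    rw [star_smul, star_star, star_mul, star_star, (hr k).isSelfAdjoint.star_eq, ← hx, ← smul_add]
    congr 1
    noncomm_ring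
  have h1 : ∀ k, ‖q k * x k‖ ≤ C := fun k =>
    (norm_mul_le _ _).trans ((mul_le_of_le_one_left (norm_nonneg _) (hq k).norm_le).trans
      (hC k))
  have h2 : ∀ k, ‖r k * star ((1 - q k) * x k)‖ ≤ C := fun k => by
    refine (norm_mul_le _ _).trans
      ((mul_le_of_le_one_left (norm_nonneg _) (hr k).norm_le).trans ?_)
    rw [norm_star]
    exact (norm_mul_le _ _).trans
      ((mul_le_of_le_one_left (norm_nonneg _) (hq k).one_sub.norm_le).trans (hC k))
  have h3 := norm_sum_smul_le_of_orthogonal F c _ h1 fun k l hkl => by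
    rw [star_mul, (hq k).isSelfAdjoint.star_eq, mul_assoc, ← mul_assoc (q k), hqo k l hkl]
    simp
  have h4 := norm_sum_smul_le_of_orthogonal F (fun k => star (c k)) _ h2 fun k l hkl => by
    rw [star_mul (r k), (hr k).isSelfAdjoint.star_eq, mul_assoc, ← mul_assoc (r k), hro k l hkl]
    simp
  simp only [norm_star] at h4
  rw [e]
  refine (norm_add_le _ _).trans ?_
  rw [norm_star]
  linarith

namespace CondExp

variable {D B : Type*} [CStarAlgebra D] [CStarAlgebra B] (P : CondExp D B)
variable {ι : Type*} [DecidableEq ι]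

/-! ### The projections onto the words with a given first index -/

/-- The projection onto the words that begin with the index `i`. -/
def projPre (i : ι) : P.PreFock ι →ₗ[ℂ] P.PreFock ι :=
  Finsupp.lsum ℂ fun w : P.Word ι => if P.headIdx w.1 = some i then P.gen w else 0

lemma projPre_gen (i : ι) (w : P.Word ι) (b : B) :
    P.projPre i (P.gen w b) = if P.headIdx w.1 = some i then P.gen w b else 0 := by
  refine (Finsupp.lsum_single _ _ _ _).trans ?_
  split_ifs <;> simp

lemma projPre_projPre (i j : ι) (x : P.PreFock ι) :
    P.projPre i (P.projPre j x) = if i = j then P.projPre i x else 0 := by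
  induction x using preFock_induction with
  | h0 => simp
  | ha x x' hx hx' => rw [map_add, map_add, hx, hx']; split_ifs <;> simp
  | hg w b =>
    rw [projPre_gen]
    split_ifs with h1 h2 h2
    · rfl
    · rw [projPre_gen, if_neg (by rw [h1]; simpa using Ne.symm h2)]
    · rw [projPre_gen, if_neg (by rwa [h2]), map_zero]
    · simp

/-- Words with different first indices are orthogonal, so keeping one first index is a symmetric
operation. -/
lemma form_projPre (i : ι) (x y : P.PreFock ι) :
    P.form (P.projPre i x) y = P.form x (P.projPre i y) := by
  induction x using preFock_induction with
  | h0 => simp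
  | ha x x' hx hx' => simp [hx, hx']
  | hg w b =>
    induction y using preFock_induction with
    | h0 => simp
    | ha x x' hx hx' => simp only [map_add, hx, hx']
    | hg w' b' =>
      rw [projPre_gen, projPre_gen]
      by_cases h : P.headIdx w.1 = P.headIdx w'.1
      · rw [h]; split_ifs <;> simp
      · have h0 := P.kernel_of_headIdx_ne h 1
        split_ifs <;> simp [h0]

/-- If neither word begins with `i`, both coefficients are `1`, and the inner product contains the
factor `exp a = 0`. In other words, `λ^i_a` sends the second word to one that begins with `i`. -/
lemma form_pre_sub_projPre (i : ι) (a : D) (ha : P.exp a = 0) (x y : P.PreFock ι) :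
    P.form (x - P.projPre i x) (P.pre i a (y - P.projPre i y)) = 0 := by
  induction x using preFock_induction with
  | h0 => simp
  | ha x x' hx hx' =>
    rw [map_add, add_sub_add_comm, map_add, LinearMap.add_apply, hx, hx', add_zero]
  | hg w b =>
    induction y using preFock_induction with
    | h0 => simp
    | ha x x' hx hx' =>
      rw [map_add, add_sub_add_comm, map_add, map_add, hx, hx', add_zero]
    | hg w' b' =>
      rw [projPre_gen, projPre_gen]
      split_ifs with h1 h2 h2
      · simp
      · simp
      · simp
      · rw [sub_zero, sub_zero, form_gen_pre, (P.rest_of_headIdx_ne h1).2,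
          (P.rest_of_headIdx_ne h2).2, star_one, one_mul, mul_one, ha]
        simp

/-- For a symmetric idempotent, Cauchy–Schwarz reads `‖p x‖² = ‖⟨x, p x⟩‖ ≤ ‖x‖ ‖p x‖`. -/
lemma norm_projPre_le (i : ι) (x : P.PreFock ι) : ‖P.projPre i x‖ ≤ 1 * ‖x‖ := by
  rw [one_mul]
  have h : ‖P.projPre i x‖ ^ 2 ≤ ‖x‖ * ‖P.projPre i x‖ := by
    rw [norm_sq, form_projPre, projPre_projPre, if_pos rfl]
    exact P.norm_form_le _ _
  by_cases h0 : ‖P.projPre i x‖ = 0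
  · rw [h0]; exact norm_nonneg x
  · rw [sq] at h
    exact le_of_mul_le_mul_right h (lt_of_le_of_ne (norm_nonneg _) (Ne.symm h0))

/-- The projection onto the words that begin with the index `i`, on the Hilbert module. -/
def projCLM (i : ι) : P.Fock ι →L[ℂ] P.Fock ι :=
  P.extend ((P.projPre i).mkContinuous 1 (P.norm_projPre_le i))

@[simp] lemma projCLM_toFock (i : ι) (x : P.PreFock ι) :
    P.projCLM i (P.toFock x) = P.toFock (P.projPre i x) :=
  P.extend_toFock _ x

lemma isAdj_projCLM (i : ι) : P.IsAdj (P.projCLM i) (P.projCLM i) := fun x y =>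
  P.fock_induction₂ (p := fun x y => P.ip (P.projCLM i x) y = P.ip x (P.projCLM i y)) x y
    (isClosed_eq (by fun_prop) (by fun_prop)) fun x y => by
      rw [projCLM_toFock, projCLM_toFock, ip_toFock, ip_toFock, form_projPre]

/-- The projection onto the words that begin with the index `i`, as an adjointable operator. -/
def projOp (i : ι) : P.adjointable ι := ⟨P.projCLM i, P.projCLM i, P.isAdj_projCLM i⟩

lemma projOp_mul_projOp (i j : ι) : P.projOp i * P.projOp j = if i = j then P.projOp i else 0 := by
  have h : ∀ x, P.projCLM i (P.projCLM j (P.toFock x))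
      = P.toFock (if i = j then P.projPre i x else 0) := fun x => by
    rw [projCLM_toFock, projCLM_toFock, projPre_projPre]
  split_ifs with hij <;> refine Subtype.ext (clm_ext fun x y => ?_)
  · change P.ip _ (P.projCLM i (P.projCLM j (P.toFock y))) = P.ip _ (P.projCLM i (P.toFock y))
    rw [h, if_pos hij, projCLM_toFock]
  · change P.ip _ (P.projCLM i (P.projCLM j (P.toFock y))) = P.ip _ 0
    rw [h, if_neg hij, map_zero]

lemma isStarProjection_projOp (i : ι) : IsStarProjection (P.projOp i) where
  isIdempotentElem := by rw [IsIdempotentElem, projOp_mul_projOp, if_pos rfl]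
  isSelfAdjoint := star_eq_of_isAdj (T := P.projOp i) (P.isAdj_projCLM i)

/-- This is the source of all cancellation, and the point where centredness of the letters enters
the norm estimate. -/
lemma compression_lam (i : ι) (a : D) (ha : P.exp a = 0) :
    (1 - P.projOp i) * P.lam i a * (1 - P.projOp i) = 0 :=
  Subtype.ext <| clm_ext fun x y => by
    have h1 : ∀ x, P.toFock x - P.projCLM i (P.toFock x) = P.toFock (x - P.projPre i x) := fun x => by
      rw [map_sub, projCLM_toFock]
    change P.ip (P.toFock x) (P.lamCLM i a (P.toFock y - P.projCLM i (P.toFock y))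
      - P.projCLM i (P.lamCLM i a (P.toFock y - P.projCLM i (P.toFock y)))) = P.ip _ 0
    rw [ip_sub, ← P.isAdj_projCLM i]
    have h2 : ∀ u v w : P.Fock ι, P.ip u w - P.ip v w = P.ip (u - v) w := fun u v w => by
      rw [sub_eq_iff_eq_add, ← add_ip, sub_add_cancel]
    rw [h2, h1, h1, lamCLM_toFock, ip_toFock, form_pre_sub_projPre _ _ _ ha, ← map_zero P.toFock,
      ip_toFock, map_zero]

/-- The product of a reduced word, cut down to the complement of the words that begin with its
first index, lives on the words that begin with its last index. -/
lemma compression_wordProd (l : List (P.Letter ι)) (hl : l.IsChain fun p q => p.1 ≠ q.1)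
    (h : l ≠ []) :
    (1 - P.projOp (l.head h).1) * P.inclOp (P.wordProd l)
      = (1 - P.projOp (l.head h).1) * P.inclOp (P.wordProd l) * P.projOp (l.getLast h).1 := by
  induction l with
  | nil => exact absurd rfl h
  | cons p t ih =>
    obtain ⟨i, a⟩ := p
    have h0 := P.compression_lam i a a.2
    rw [mul_sub, mul_one, sub_eq_zero] at h0
    have hi : ∀ a, P.inclOp (P.emb i a) = P.lam i a := fun _ => rfl
    rw [wordProd_cons, map_mul, hi, List.head_cons, ← mul_assoc]
    rcases t with _ | ⟨⟨j, c⟩, t⟩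
    · rw [wordProd_nil, map_one, mul_one]
      exact h0
    -- Neighbouring indices differ, so `p i` and `p j` are orthogonal. Writing `p i` as `p i * (1 -
    -- p j)` supplies the factor on the left that the induction hypothesis for the tail requires.
    · have hij : P.projOp i = P.projOp i * (1 - P.projOp j) := by
        rw [List.isChain_cons_cons] at hl
        rw [mul_sub, projOp_mul_projOp, if_neg hl.1, mul_one, sub_zero]
      have ih' := ih (List.IsChain.tail hl) (List.cons_ne_nil _ _)
      rw [List.head_cons] at ih'
      rw [List.getLast_cons (List.cons_ne_nil _ _), h0, hij]
      simp only [mul_assoc] at ih' ⊢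
      rw [← ih']

/-! ### The vacuum expectation -/

lemma projCLM_vac (i : ι) : P.projCLM i (P.vac ι) = 0 := by
  rw [vac, projCLM_toFock, projPre_gen, if_neg (by simp [nilWord, headIdx]), map_zero]

/-- In `X = p i X + (1 - p i) X p j` the second term kills the vacuum, and the first takes it into
the range of `p i`, which is orthogonal to the vacuum. -/
lemma vacExp_wordProd {l : List (P.Letter ι)} (hl : l.IsChain fun p q => p.1 ≠ q.1)
    (h : l ≠ []) : P.vacExp (P.wordProd l) = 0 := by
  set X := P.inclOp (P.wordProd l) with hX
  set i := (l.head h).1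
  set j := (l.getLast h).1
  have h1 : X = P.projOp i * X + (1 - P.projOp i) * X * P.projOp j := by
    rw [← P.compression_wordProd l hl h]; noncomm_ring
  have h0 : ∀ x, P.ip x (0 : P.Fock ι) = 0 := fun x => by
    have := P.ip_smul 0 x 0
    rwa [zero_smul, zero_smul] at this
  change P.ip (P.vac ι) (X.1 (P.vac ι)) = 0
  have h2 : X.1 (P.vac ι) = P.projCLM i (X.1 (P.vac ι)) := by
    conv_lhs => rw [h1]
    change P.projCLM i (X.1 (P.vac ι)) + ((1 - P.projOp i) * X).1 (P.projCLM j (P.vac ι)) = _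
    rw [projCLM_vac, map_zero, add_zero]
  rw [h2, ← P.isAdj_projCLM, projCLM_vac, ← star_ip, h0, star_zero]

/-- An inequality only, as `B` may be the zero algebra. -/
lemma norm_vac_le : ‖P.vac ι‖ ≤ 1 := by
  rw [vac, norm_toFock, norm_def, form_gen]
  simpa [nilWord, P.exp_one] using norm_one_le' B

lemma norm_vacExp_le (x : P.FreeProduct ι) : ‖P.vacExp x‖ ≤ ‖x‖ := by
  have h := P.norm_vac_le (ι := ι)
  calc ‖P.vacExp x‖ ≤ ‖P.vac ι‖ * ‖(P.inclOp x).1 (P.vac ι)‖ := P.norm_ip_le _ _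
    _ ≤ ‖P.vac ι‖ * (‖x‖ * ‖P.vac ι‖) := by
      gcongr; exact (P.inclOp x).1.le_opNorm _
    _ ≤ 1 * (‖x‖ * 1) := by gcongr
    _ = ‖x‖ := by ring

section
variable [Inhabited ι]

lemma norm_baseExp_le (x : P.FreeProduct ι) : ‖P.baseExp x‖ ≤ ‖x‖ :=
  (NonUnitalStarAlgHom.norm_apply_le P.baseEmb (P.vacExp x)).trans (P.norm_vacExp_le x)

lemma continuous_baseExp : Continuous (P.baseExp : P.FreeProduct ι →ₗ[ℂ] P.FreeProduct ι) :=
  AddMonoidHomClass.continuous_of_bound _ 1 fun x => by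
    rw [one_mul]; exact P.norm_baseExp_le x

lemma baseExp_baseEmb (b : B) : P.baseExp (P.baseEmb (ι := ι) b) = P.baseEmb b := by
  change P.baseEmb (P.vacExp _) = _
  rw [P.baseEmb_apply default b, vacExp_emb, P.exp_incl, P.baseEmb_apply default]

lemma baseExp_wordProd {l : List (P.Letter ι)} (hl : l.IsChain fun p q => p.1 ≠ q.1)
    (h : l ≠ []) : P.baseExp (P.wordProd l) = 0 := by
  change P.baseEmb (P.vacExp _) = _
  rw [P.vacExp_wordProd hl h, map_zero]

/-- A closed linear property of the free product may be checked on `B` and on reduced words. -/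
lemma freeProduct_induction {p : P.FreeProduct ι → Prop} (hp : IsClosed {x | p x})
    (base : ∀ b, p (P.baseEmb b))
    (word : ∀ l : List (P.Letter ι), l ≠ [] → (l.IsChain fun p q => p.1 ≠ q.1) →
      p (P.wordProd l))
    (add : ∀ x y, p x → p y → p (x + y)) (smul : ∀ (z : ℂ) x, p x → p (z • x))
    (x : P.FreeProduct ι) : p x :=
  isClosed_property P.dense_reducedSpan.denseRange_val hp (fun x => by
    obtain ⟨x, hx⟩ := x
    change p x
    induction hx using Submodule.span_induction with
    | mem x h =>
      obtain ⟨b, rfl⟩ | ⟨l, h, hl, rfl⟩ := h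
      · exact base b
      · exact word l h hl
    | zero => simpa using base 0
    | add x y _ _ hx hy => exact add x y hx hy
    | smul z x _ hx => exact smul z x hx) x

end

end CondExp

namespace CondExp

variable {D B : Type*} [CStarAlgebra D] [CStarAlgebra B] {P : CondExp D B}

/-! ### The free shift is mixing -/

namespace IsFreeShift

variable {α : P.FreeProduct ℤ ≃⋆ₐ[ℂ] P.FreeProduct ℤ}

lemma iterate_emb (hα : P.IsFreeShift α) (k : ℕ) (i : ℤ) (a : D) :
    α^[k] (P.emb i a) = P.emb (i + k) a := by
  induction k with
  | zero => simp
  | succ k ih =>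
    rw [Function.iterate_succ_apply', ih, hα, Nat.cast_succ, add_assoc]

/-- The copy of `B` may be realised at any index, so moving the index does not change it. -/
lemma iterate_baseEmb (hα : P.IsFreeShift α) (k : ℕ) (b : B) :
    α^[k] (P.baseEmb b) = P.baseEmb b := by
  rw [P.baseEmb_apply 0, hα.iterate_emb, ← P.baseEmb_apply, P.baseEmb_apply 0]

lemma iterate_wordProd (hα : P.IsFreeShift α) (k : ℕ) (l : List (P.Letter ℤ)) :
    α^[k] (P.wordProd l) = P.wordProd (P.relabelList (Equiv.addRight (k : ℤ)) l) := by
  induction l with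
  | nil => exact Function.iterate_fixed (map_one α) k
  | cons p t ih =>
    obtain ⟨i, a⟩ := p
    rw [wordProd_cons, iterate_map_mul, ih, hα.iterate_emb]
    exact (P.wordProd_cons _ _ _).symm

end IsFreeShift

lemma iterate_smul (α : P.FreeProduct ℤ ≃⋆ₐ[ℂ] P.FreeProduct ℤ) (k : ℕ) (z : ℂ)
    (x : P.FreeProduct ℤ) : α^[k] (z • x) = z • α^[k] x := by
  induction k with
  | zero => rfl
  | succ k ih => rw [Function.iterate_succ_apply', ih, map_smul, Function.iterate_succ_apply']

lemma norm_iterate_le (α : P.FreeProduct ℤ ≃⋆ₐ[ℂ] P.FreeProduct ℤ) (k : ℕ)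
    (x : P.FreeProduct ℤ) : ‖α^[k] x‖ ≤ ‖x‖ := by
  induction k with
  | zero => simp
  | succ k ih =>
    rw [Function.iterate_succ_apply']
    exact (NonUnitalStarAlgHom.norm_apply_le (α : P.FreeProduct ℤ →⋆ₐ[ℂ] P.FreeProduct ℤ) _).trans
      ih

namespace IsFreeShift

variable {α : P.FreeProduct ℤ ≃⋆ₐ[ℂ] P.FreeProduct ℤ}

/-- Combinations of the shifts of a reduced word have small norm. -/
lemma norm_sum_iterate_le (hα : P.IsFreeShift α) {l : List (P.Letter ℤ)} (h : l ≠ [])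
    (hl : l.IsChain fun p q => p.1 ≠ q.1) (F : Finset ℕ) (c : ℕ → ℂ) :
    ‖∑ k ∈ F, c k • α^[k] (P.wordProd l)‖
      ≤ 2 * ‖P.wordProd l‖ * √(∑ k ∈ F, ‖c k‖ ^ 2) := by
  -- First indices are compared only with first indices, and last with last. Two shifts of the word
  -- may therefore share indices elsewhere.
  have ho : ∀ (i : ℤ) (k m : ℕ), k ≠ m → P.projOp (i + k) * P.projOp (i + m) = 0 :=
    fun i k m hkm => by
      rw [projOp_mul_projOp, if_neg (by simpa using hkm)]
  -- The projections are elements of `adjointable`, so the estimate is made there; the free product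
  -- carries the same norm.
  have key := norm_sum_smul_le_of_compression F c (fun k => P.inclOp (α^[k] (P.wordProd l)))
    (fun k => P.projOp ((l.head h).1 + k)) (fun k => P.projOp ((l.getLast h).1 + k))
    (C := ‖P.wordProd l‖) (fun k => norm_iterate_le α k _)
    (fun k => P.isStarProjection_projOp _) (fun k => P.isStarProjection_projOp _)
    (ho _) (ho _) fun k => by
      have hne : P.relabelList (Equiv.addRight (k : ℤ)) l ≠ [] := by simpa [relabelList] using h
      have h1 := P.compression_wordProd _
        (P.isChain_relabelList (Equiv.addRight (k : ℤ)) hl) hne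
      rw [hα.iterate_wordProd]
      simpa [relabelList, List.head_map, List.getLast_map] using h1
  have e : ∑ k ∈ F, c k • P.inclOp (α^[k] (P.wordProd l))
      = P.inclOp (∑ k ∈ F, c k • α^[k] (P.wordProd l)) := by
    rw [map_sum]
    simp only [map_smul]
  rw [e] at key
  exact key

/-! ### Ergodic averages and the fixed-point algebra -/

/-- Since `α` is contractive, the averages are equicontinuous, and convergence needs checking only
on `B`, where they are eventually constant, and on reduced words, where they decay like `n^{-1/2}`.
-/
lemma tendsto_birkhoffAverage (hα : P.IsFreeShift α) (x : P.FreeProduct ℤ) :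
    Filter.Tendsto (birkhoffAverage ℂ α id · x) Filter.atTop (nhds (P.baseExp x)) := by
  have hlip : LipschitzWith 1 α := LipschitzWith.of_dist_le_mul fun x y => by
    rw [NNReal.coe_one, one_mul, dist_eq_norm, dist_eq_norm, ← map_sub]
    exact norm_iterate_le α 1 _
  have hid : ∀ n x, birkhoffAverage ℂ α id n x
      = (n : ℂ)⁻¹ • ∑ k ∈ Finset.range n, α^[k] x := fun _ _ => rfl
  refine P.freeProduct_induction (p := fun x => Filter.Tendsto (birkhoffAverage ℂ α id · x)
    Filter.atTop (nhds (P.baseExp x))) (isClosed_setOfPred_tendsto_birkhoffAverage ℂ hlip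
    uniformContinuous_id P.continuous_baseExp) ?_ ?_ ?_ ?_ x
  · intro b
    rw [baseExp_baseEmb]
    refine tendsto_const_nhds.congr' ?_
    -- The average of length `0` is `0` by convention and has to be excluded.
    filter_upwards [Filter.eventually_ne_atTop 0] with n hn
    simp only [hid, hα.iterate_baseEmb, Finset.sum_const, Finset.card_range]
    rw [← Nat.cast_smul_eq_nsmul ℂ, smul_smul, inv_mul_cancel₀ (by exact_mod_cast hn), one_smul]
  · intro l h hl
    rw [P.baseExp_wordProd hl h]
    -- With `n` weights equal to `1 / n` the sum of squares is `1 / n`; for `n = 0` both sides are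
    -- `0`.
    have hb : ∀ n : ℕ, ‖birkhoffAverage ℂ α id n (P.wordProd l)‖
        ≤ 2 * ‖P.wordProd l‖ * √((n : ℝ)⁻¹) := fun n => by
      have h1 := hα.norm_sum_iterate_le h hl (Finset.range n) fun _ => (n : ℂ)⁻¹
      rw [← Finset.smul_sum, ← hid] at h1
      refine h1.trans_eq ?_
      congr 2
      rcases eq_or_ne (n : ℝ) 0 with h0 | h0
      · simp [h0]
      · simp only [norm_inv, Complex.norm_natCast, Finset.sum_const, Finset.card_range,
          nsmul_eq_mul]
        field_simp
    refine squeeze_zero_norm hb ?_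
    have h2 := (tendsto_inv_atTop_nhds_zero_nat (𝕜 := ℝ)).sqrt.const_mul (2 * ‖P.wordProd l‖)
    simpa using h2
  · intro x y hx hy
    rw [map_add]
    refine (hx.add hy).congr fun n => ?_
    simp only [hid, iterate_map_add, Finset.sum_add_distrib, smul_add]
  · intro z x hx
    rw [map_smul]
    refine (hx.const_smul z).congr fun n => ?_
    simp only [hid, iterate_smul, ← Finset.smul_sum, smul_comm z]

/-- The values of `baseExp` lie in the copy of `B`, which is fixed. Conversely, a fixed `x` is its
own average, so the limit of the averages identifies it with `baseExp x`. -/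
lemma isConditionalExpectation (hα : P.IsFreeShift α) :
    IsConditionalExpectation (fixedPoints α) P.baseExp where
  mem x := hα.iterate_baseEmb 1 (P.vacExp x)
  map_of_mem x hx := by
    refine tendsto_nhds_unique (hα.tendsto_birkhoffAverage x) (tendsto_const_nhds.congr' ?_)
    filter_upwards [Filter.eventually_ne_atTop 0] with n hn
    have h1 : ∀ k, α^[k] x = x := Function.iterate_fixed hx
    simp only [birkhoffAverage, birkhoffSum, id, h1, Finset.sum_const, Finset.card_range]
    rw [← Nat.cast_smul_eq_nsmul ℂ, smul_smul, inv_mul_cancel₀ (by exact_mod_cast hn), one_smul]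
  norm_le := P.norm_baseExp_le

/-! ### Square summability and mixing -/

/-- By duality: a bounded functional turns the `ℓ²` estimate for combinations of shifts into square
summability of its values on the orbit of a reduced word. -/
lemma isEMixing (hα : P.IsFreeShift α) : IsEMixing α P.baseExp := by
  intro φ hφ
  obtain ⟨C, hC⟩ := hφ.exists_norm_le
  have hφc : Continuous φ := AddMonoidHomClass.continuous_of_bound φ C hC
  have hcl : IsClosed {x | Filter.Tendsto (fun n : ℕ => φ (α^[n] x)) Filter.atTop
      (nhds (φ (P.baseExp x)))} := by
    -- The functionals `φ ∘ α^n` share the Lipschitz constant `C`, so the set on which they converge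
    -- to `φ ∘ E` is closed.
    refine Equicontinuous.isClosed_setOfPred_tendsto (F := fun n x => φ (α^[n] x))
      (Metric.equicontinuous_of_continuity_modulus (fun t => C * t) ?_ _ fun x y k => ?_)
      (hφc.comp P.continuous_baseExp)
    · simpa using (continuous_const.mul continuous_id).tendsto (f := fun t : ℝ => (C : ℝ) * t) 0
    · rw [dist_eq_norm, dist_eq_norm, ← map_sub, ← iterate_map_sub]
      exact (hC _).trans (by gcongr; exact norm_iterate_le α k _)
  refine P.freeProduct_induction hcl ?_ ?_ ?_ ?_
  · intro b
    simp only [baseExp_baseEmb, hα.iterate_baseEmb]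
    exact tendsto_const_nhds
  · intro l h hl
    rw [P.baseExp_wordProd hl h, map_zero]
    set u : ℕ → ℂ := fun n => φ (α^[n] (P.wordProd l))
    -- The bound of `φ` times the constant of `norm_sum_iterate_le`.
    set K : ℝ := C * (2 * ‖P.wordProd l‖)
    have hsum : ∀ n, ∑ k ∈ Finset.range n, ‖u k‖ ^ 2 ≤ K ^ 2 := fun n => by
      set S := ∑ k ∈ Finset.range n, ‖u k‖ ^ 2 with hS
      have hS0 : 0 ≤ S := Finset.sum_nonneg fun _ _ => by positivity
      -- Conjugate weights make the value of `φ` on the combination equal to `S`, while its norm is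
      -- controlled by `√S`.
      have h1 := hα.norm_sum_iterate_le h hl (Finset.range n) fun k => star (u k)
      simp only [norm_star, ← hS] at h1
      have h2 : φ (∑ k ∈ Finset.range n, star (u k) • α^[k] (P.wordProd l)) = (S : ℂ) := by
        rw [map_sum, hS]
        push_cast
        refine Finset.sum_congr rfl fun k _ => ?_
        rw [map_smul, smul_eq_mul]
        exact Complex.conj_mul' (u k)
      have h3 := hC (∑ k ∈ Finset.range n, star (u k) • α^[k] (P.wordProd l))
      rw [h2, Complex.norm_real, Real.norm_of_nonneg hS0] at h3
      have h4 : S ≤ K * √S := by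
        refine h3.trans ((mul_le_mul_of_nonneg_left h1 C.2).trans_eq ?_)
        simp only [K, mul_assoc]
        rfl
      have h5 : √S * √S = S := Real.mul_self_sqrt hS0
      -- From `2 S ≤ 2 K √S ≤ S + K²`, without dividing by `√S`, which may vanish.
      nlinarith [sq_nonneg (√S - K)]
    have hlim := (summable_of_sum_range_le (fun n => by positivity) hsum).tendsto_atTop_zero
    rw [tendsto_zero_iff_norm_tendsto_zero]
    simpa using hlim.sqrt
  · intro x y hx hy
    simp only [iterate_map_add, map_add]
    exact hx.add hy
  · intro z x hx
    simp only [iterate_smul, map_smul]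
    exact hx.const_smul z

end IsFreeShift

end CondExp
end

theorem theorem3p1 {D : Type*} [CStarAlgebra D] (B : StarSubalgebra ℂ D) [IsClosed (B : Set D)]
    (E₀ : D →ₗ[ℂ] D) (hE₀ : IsConditionalExpectation B E₀) :
    (∃! α : (CondExp.ofSubalgebra B E₀ hE₀).FreeProduct ℤ ≃⋆ₐ[ℂ]
        (CondExp.ofSubalgebra B E₀ hE₀).FreeProduct ℤ,
      (CondExp.ofSubalgebra B E₀ hE₀).IsFreeShift α) ∧
    ∀ α : (CondExp.ofSubalgebra B E₀ hE₀).FreeProduct ℤ ≃⋆ₐ[ℂ]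
        (CondExp.ofSubalgebra B E₀ hE₀).FreeProduct ℤ,
      (CondExp.ofSubalgebra B E₀ hE₀).IsFreeShift α →
        IsConditionalExpectation (fixedPoints α) (CondExp.ofSubalgebra B E₀ hE₀).baseExp ∧
        IsEMixing α (CondExp.ofSubalgebra B E₀ hE₀).baseExp :=
  ⟨CondExp.existsUnique_isFreeShift _, fun _ hα => ⟨hα.isConditionalExpectation, hα.isEMixing⟩⟩
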